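/- **Notation.** For $n\ge 1$ expectations on $\{0,1\}^n$ are with respect to the uniform measure; $\|f\|_p=(\mathbb E|f|^p)^{1/p}$ for $p>0$; $(T_\epsilon f)(x)=\sum_{y}\epsilon^{|y-x|}(1-\epsilon)^{n-|y-x|}f(y)$, where $|\cdot|$ is Hamming distance; for $q>1$ and $\mathbb E|f|=1$, $\mathrm{Ent}_q(f)=\frac{1}{q-1}\log_2\|f\|_q^q$. Let $H(t)=t\log_2\frac1t+(1-t)\log_2\frac1{1-t}$ and let $H^{-1}:[0,1]\to[0,\frac12]$ be its inverse. For $0\le x\le 1$, $0\le\epsilon\le\frac12$ put $\sigma=H^{-1}(x)$, $$y(x,\epsilon)=\frac{-\epsilon^2+\epsilon\sqrt{\epsilon^2+4(1-2\epsilon)\sigma(1-\sigma)}}{2(1-2\epsilon)}\quad(\epsilon<\tfrac12),\qquad y(x,\tfrac12)=\sigma(1-\sigma),$$ $$\Phi(x,\epsilon)=\tfrac12\Big(x-1+\sigma H\big(\tfrac{y}{\sigma}\big)+(1-\sigma)H\big(\tfrac{y}{1-\sigma}\big)+2y\log_2\epsilon+(1-2y)\log_2(1-\epsilon)\Big),\quad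 y=y(x,\epsilon),$$ with the conventions $0\cdot H(0/0)=0\cdot\log_2 0=0$, and $\phi_\epsilon(x)=\Phi(x,2\epsilon(1-\epsilon))$. Let $q_0=1+(1-2\epsilon)^2$. For $q>1$ and $0\le x\le1$ let $y=\frac{q-1}{q}x+\frac1q$; set $\kappa_{2,q}(0,\epsilon)=q_0$, and for $x>0$ $$\kappa_{2,q}(x,\epsilon)=\begin{cases}q_0 & y\le\frac1{q_0},\\[2pt] -\frac{x}{\phi_\epsilon(1-x)} & y>\frac1{q_0}\text{ and }-\frac{x}{\phi_\epsilon(1-x)}\ge q,\\[2pt] \frac{\alpha_0-1}{\phi_\epsilon(\alpha_0)} & y>\frac1{q_0}\text{ and }-\frac{x}{\phi_\epsilon(1-x)}<q,\end{cases}$$ where $\alpha_0\in[0,1)$ is determined by $1-\alpha_0-\frac{\alpha_0\phi_\epsilon(\alpha_0)}{1-\alpha_0}=y$. **Theorem.** Let $q>1$. 1. The function $\kappa_{2,q}$ is well defined on $[0,1]\times[0,\frac12]$: for $0<x\le1$ and $0\le\epsilon\le\frac12$ one has $\phi_\epsilon(1-x)\ne0$, and if $y>\frac1{q_0}$ then the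 equation for $\alpha_0$ has exactly one solution in $[0,1)$. For every $0\le\epsilon\le\frac12$, $\kappa_{2,q}(x,\epsilon)$ is (weakly) decreasing in $x\in[0,1]$ and $\kappa_{2,q}(0,\epsilon)=1+(1-2\epsilon)^2$. 2. For all $n\ge1$, $0\le\epsilon\le\frac12$ and every non-zero $f:\{0,1\}^n\to\mathbb R$, $\frac1n\mathrm{Ent}_q\big(\frac{f}{\|f\|_1}\big)\in[0,1]$ and $$\|T_\epsilon f\|_2\le\|f\|_\kappa,\qquad \kappa=\kappa_{2,q}\Big(\tfrac1n\mathrm{Ent}_q\big(\tfrac{f}{\|f\|_1}\big),\epsilon\Big).$$ 3. This is essentially tight: for all $0<x<1$, $0<\epsilon<\frac12$ and $0<y<\kappa_{2,q}(x,\epsilon)$ there exist arbitrarily large $n$ and a nonnegative function $f$ on $\{0,1\}^n$ with $\mathbb Ef=1$, $\frac1n\mathrm{Ent}_q(f)\ge x$ and $\|T_\epsilon f\|_2>\|f\|_y$. Moreover, $f$ can be taken of the form $a+b\,1_{S}+c\,1_{S'}$ with $a,b>0$, $c\ge0$ and $S,S'$ Hamming spheres around $0$ of radii at most $n$. -/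

import Mathlib

namespace NoiseCube

noncomputable section

/-- The boolean cube `{0,1}^n`. -/
abbrev Cube (n : ℕ) : Type := Fin n → Bool

/-- Expectation with respect to the uniform measure on the cube. -/
def mean {n : ℕ} (f : Cube n → ℝ) : ℝ := (∑ x, f x) / 2 ^ n

/-- The norm `‖f‖_p = (E |f|^p)^(1/p)`, for `p > 0`. -/
def lpNorm {n : ℕ} (p : ℝ) (f : Cube n → ℝ) : ℝ :=
  mean (fun x => |f x| ^ p) ^ (1 / p)

/-- The noise operator `T_ε`. -/
def noise {n : ℕ} (ε : ℝ) (f : Cube n → ℝ) : Cube n → ℝ := fun x =>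
  ∑ y, ε ^ hammingDist y x * (1 - ε) ^ (n - hammingDist y x) * f y

/-- The Rényi entropy `Ent_q(f) = (1/(q-1)) log₂ ‖f‖_q^q` (for functions with `E |f| = 1`). -/
def renyiEnt {n : ℕ} (q : ℝ) (f : Cube n → ℝ) : ℝ :=
  1 / (q - 1) * Real.logb 2 (lpNorm q f ^ q)

/-- The indicator function of the Hamming sphere of radius `r` around zero. -/
def sphere (n r : ℕ) : Cube n → ℝ := fun x =>
  if hammingDist x (fun _ => false) = r then 1 else 0

/-- The binary entropy function, in bits. -/
def H (t : ℝ) : ℝ := Real.binEntropy t / Real.log 2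

/-- The inverse of `H : [0,1/2] → [0,1]`. -/
def Hinv (x : ℝ) : ℝ := Function.invFunOn H (Set.Icc 0 (1 / 2)) x

/-- The auxiliary function `y(x, ε)`, extended by continuity to `ε = 1/2`. -/
def yAux (x ε : ℝ) : ℝ :=
  if ε = 1 / 2 then Hinv x * (1 - Hinv x)
  else (-ε ^ 2 + ε * √(ε ^ 2 + 4 * (1 - 2 * ε) * (Hinv x * (1 - Hinv x)))) / (2 * (1 - 2 * ε))

/-- The function `Φ(x, ε)`. The conventions `0 / 0 = 0` and `log 0 = 0` give
`0 · H(0/0) = 0` at `x = 0` and `0 · log₂ 0 = 0` at `ε = 0`. -/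
def Phi (x ε : ℝ) : ℝ :=
  1 / 2 * (x - 1 + Hinv x * H (yAux x ε / Hinv x)
    + (1 - Hinv x) * H (yAux x ε / (1 - Hinv x))
    + 2 * yAux x ε * Real.logb 2 ε + (1 - 2 * yAux x ε) * Real.logb 2 (1 - ε))

/-- `φ_ε(x) = Φ(x, 2ε(1-ε))`. -/
def phi (ε x : ℝ) : ℝ := Phi x (2 * ε * (1 - ε))

/-- `q₀ = 1 + (1-2ε)²`. -/
def q0 (ε : ℝ) : ℝ := 1 + (1 - 2 * ε) ^ 2

/-- `y = ((q-1)/q) x + 1/q`. -/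
def yLin (q x : ℝ) : ℝ := (q - 1) / q * x + 1 / q

/-- `α ∈ [0,1)` solves the equation `1 - α - α φ_ε(α) / (1-α) = y`. -/
def IsAlpha0 (ε y α : ℝ) : Prop :=
  α ∈ Set.Ico (0 : ℝ) 1 ∧ 1 - α - α * phi ε α / (1 - α) = y

open Classical in
/-- The solution `α₀` of the equation above (`0` if there is none). -/
def alpha0 (ε y : ℝ) : ℝ :=
  if h : ∃ α, IsAlpha0 ε y α then h.choose else 0

open Classical in
/-- The function `κ_{2,q}(x, ε)`. -/
def kappa (q x ε : ℝ) : ℝ :=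
  if x = 0 then q0 ε
  else if yLin q x ≤ 1 / q0 ε then q0 ε
  else if q ≤ -(x / phi ε (1 - x)) then -(x / phi ε (1 - x))
  else (alpha0 ε (yLin q x) - 1) / phi ε (alpha0 ε (yLin q x))

end

end NoiseCube

/-! Put `δ = 2ε(1-ε)`, so that `T_ε² = T_δ` and `‖T_ε f‖₂² = ⟨f, T_δ f⟩`. Suppose `0 < ε < 1/2`; at
the endpoints `φ_ε` is affine. Weight the pairs of bits by `(1-δ, δz, δz, (1-δ)z²)`, with `0 ≤ z ≤
1`. The entropy `α` of the marginal and the value `φ_ε(α)` become explicit functions of `z`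
(`Phi_entropyParam`), and `dφ/dα = 1/p`, where `p = criticalExp δ z` increases from near 1 to `q₀`
as `z` runs over `(0,1)`. Hence `φ_ε` is concave. The tangent at `α` has value `φ(α) + (1-α)/p` at
abscissa 1, which is the base 2 logarithm of a constant valid in the two-point inequality between
`L²` and `L^p` (`twoPoint_criticalExp`). Tensorizing, `‖T_ε f‖₂ ≤ 2^(n(φ(α)+(1-α)/p)) ‖f‖_p`;
`exists_supporting_exponent` collects all this.

Let `s = -φ(α)/(1-α)` be the slope of the chord from `α` to 1, where `φ(1) = 0`. By concavity `s ≤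
1/p`, and the exponent above is `n(1-α)(1/p - s)`. If `‖f‖₁ = 1`, interpolating `L^p` between `L¹`
and `L^(1/s)` gives `‖T_ε f‖₂ ≤ ‖f‖_(1/s)` as soon as `‖f‖_(1/s) ≥ 2^(n(1-α)(1-s))`
(`lpNorm_noise_le_of_le`). This lower bound must come from the given `‖f‖_q`. If `1/s ≥ q`,
log-convexity of the norms yields it with `α = 1-x`. If `1/s ≤ q`, comparison of counting-measure
norms yields it when `y - s = (1-α)(1-s)`, which is the equation for `α₀`.

For tightness, let `S` be a sphere of density about `2^(n(α-1))`. Restricting `z^|v|` to a typical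
weight shows that `‖T_ε 1_S‖₂` is about `2^(nφ(α))` or more (`eventually_exists_sphere`). A multiple
of `1_S` with mean `1/4` then has noise norm of order at least `2^(n(1-α)(1-s))`, which beats its
`L^p` norm when `p < 1/s`. A constant normalizes the mean, and a point mass at 0 (a sphere of radius
0) supplies entropy when the sphere does not. -/

namespace NoiseCube

noncomputable section

open Real Set Filter Topology

/-- The logarithm of the ratio of the two values of the noisy version of `(1, z)`. -/
def logRatio (δ z : ℝ) : ℝ := log (δ + (1 - δ) * z) - log ((1 - δ) + δ * z)

/-- The exponent `p` for which `(1, z)` is a critical point of `‖T f‖₂ / ‖f‖_p`. -/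
def criticalExp (δ z : ℝ) : ℝ := 1 + logRatio δ z / log z

/-- The normalizing constant of the coupling with weights `(1-δ, δ z, δ z, (1-δ) z²)`. -/
def couplingMass (δ z : ℝ) : ℝ := (1 - δ) * (1 + z ^ 2) + 2 * δ * z

/-- The marginal of the coupling with weights `(1-δ, δ z, δ z, (1-δ) z²)`. -/
def couplingBias (δ z : ℝ) : ℝ := z * (δ + (1 - δ) * z) / couplingMass δ z

/-- The entropy of the marginal. -/
def entropyParam (δ z : ℝ) : ℝ := H (couplingBias δ z)

/-- The value of `Φ` in terms of the parameter `z`. -/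
def phiParam (δ z : ℝ) : ℝ :=
  (log (couplingMass δ z / 2) / 2 - couplingBias δ z * log z) / log 2

/-! ### Parametrization of the concave curve by `z`. -/

section Parametrization

variable {δ z : ℝ}

lemma couplingMass_pos (h0 : 0 < δ) (h1 : δ < 1 / 2) (hz : 0 ≤ z) : 0 < couplingMass δ z := by
  unfold couplingMass
  have : 0 < 1 - δ := by linarith
  positivity

lemma logRatio_one (δ : ℝ) : logRatio δ 1 = 0 := by
  unfold logRatio; ring_nf

lemma logRatio_neg (h0 : 0 < δ) (h1 : δ < 1 / 2) (hz : z ∈ Ioo (0 : ℝ) 1) :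
    logRatio δ z < 0 := by
  obtain ⟨hz0, hz1⟩ := hz
  unfold logRatio
  have : 0 < δ + (1 - δ) * z := by nlinarith
  have := Real.log_lt_log this (show δ + (1 - δ) * z < (1 - δ) + δ * z by nlinarith)
  linarith

lemma hasDerivAt_logRatio_exp (h0 : 0 < δ) (h1 : δ < 1 / 2) (s : ℝ) :
    HasDerivAt (fun s => logRatio δ (exp s))
      ((1 - 2 * δ) * exp s / (exp s + δ * (1 - δ) * (1 - exp s) ^ 2)) s := by
  have he := exp_pos s
  have ha : 0 < 1 - δ := by linarith
  have h2 : 0 < δ + (1 - δ) * exp s := by positivity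
  have h3 : 0 < (1 - δ) + δ * exp s := by positivity
  have d1 : HasDerivAt (fun s => δ + (1 - δ) * exp s) ((1 - δ) * exp s) s :=
    ((Real.hasDerivAt_exp s).const_mul _).const_add _
  have d2 : HasDerivAt (fun s => (1 - δ) + δ * exp s) (δ * exp s) s :=
    ((Real.hasDerivAt_exp s).const_mul _).const_add _
  have := (d1.log h2.ne').sub (d2.log h3.ne')
  refine this.congr_deriv ?_
  have h4 : exp s + δ * (1 - δ) * (1 - exp s) ^ 2
      = (δ + (1 - δ) * exp s) * ((1 - δ) + δ * exp s) := by ring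
  rw [h4]
  field_simp
  ring

/-- The derivative is `(1-2δ) / (1 + δ(1-δ)(1-e^s)²/e^s)`, and `(1-e^s)²/e^s = 4 sinh²(s/2)`
decreases for `s ≤ 0`. -/
lemma convexOn_logRatio_exp (h0 : 0 < δ) (h1 : δ < 1 / 2) :
    ConvexOn ℝ (Iic 0) (fun s => logRatio δ (exp s)) := by
  refine MonotoneOn.convexOn_of_deriv (convex_Iic 0)
    (fun s _ => (hasDerivAt_logRatio_exp h0 h1 s).continuousAt.continuousWithinAt)
    (fun s _ => (hasDerivAt_logRatio_exp h0 h1 s).differentiableAt.differentiableWithinAt) ?_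
  intro s hs t ht hst
  rw [(hasDerivAt_logRatio_exp h0 h1 s).deriv, (hasDerivAt_logRatio_exp h0 h1 t).deriv]
  have hk : 0 < δ * (1 - δ) := mul_pos h0 (by linarith)
  have ht' : exp t ≤ 1 := by
    rw [interior_Iic] at ht
    exact exp_le_one_iff.2 (le_of_lt ht)
  have hs' := exp_pos s
  have ht'' := exp_pos t
  have hst' := exp_le_exp.2 hst
  have hsq : (1 - exp t) ^ 2 ≤ (1 - exp s) ^ 2 := by
    apply pow_le_pow_left₀ <;> linarith
  rw [div_le_div_iff₀ (by positivity) (by positivity)]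
  have : exp s * (1 - exp t) ^ 2 ≤ exp t * (1 - exp s) ^ 2 := by gcongr
  have h3 : 0 ≤ (1 - 2 * δ) * (δ * (1 - δ)) := mul_nonneg (by linarith) hk.le
  nlinarith [mul_le_mul_of_nonneg_left this h3]

/-- In the variable `log z` the critical exponent minus one is a chord slope anchored at 0:
convexity makes it monotone, and its limit as `z → 1` is a derivative. -/
lemma criticalExp_eq_slope (hz : 0 < z) :
    criticalExp δ z = 1 + (logRatio δ (exp (log z)) - logRatio δ (exp 0)) / (log z - 0) := by
  rw [exp_log hz, exp_zero, logRatio_one, sub_zero, sub_zero, criticalExp]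

lemma criticalExp_monotoneOn (h0 : 0 < δ) (h1 : δ < 1 / 2) :
    MonotoneOn (criticalExp δ) (Ioo 0 1) := by
  intro z hz w hw hzw
  rw [criticalExp_eq_slope hz.1, criticalExp_eq_slope hw.1]
  have hz' := log_neg hz.1 hz.2
  have hw' := log_neg hw.1 hw.2
  have := (convexOn_logRatio_exp h0 h1).secant_mono (a := 0) (x := log z) (y := log w)
    (by simp) hz'.le hw'.le hz'.ne hw'.ne (log_le_log hz.1 hzw)
  linarith

lemma tendsto_criticalExp (h0 : 0 < δ) (h1 : δ < 1 / 2) :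
    Tendsto (criticalExp δ) (𝓝[<] 1) (𝓝 (2 * (1 - δ))) := by
  have h := (hasDerivAt_logRatio_exp h0 h1 0).tendsto_slope
  have hl : Tendsto log (𝓝[<] (1 : ℝ)) (𝓝[≠] 0) := by
    refine tendsto_nhdsWithin_iff.2 ⟨?_, ?_⟩
    · have := (continuousAt_log (one_ne_zero)).tendsto
      rw [log_one] at this
      exact this.mono_left nhdsWithin_le_nhds
    · filter_upwards [Ioo_mem_nhdsLT (show (0 : ℝ) < 1 by norm_num)] with z hz
      exact (log_neg hz.1 hz.2).ne
  have h2 := (h.comp hl).const_add 1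
  have : 1 + (1 - 2 * δ) * exp 0 / (exp 0 + δ * (1 - δ) * (1 - exp 0) ^ 2) = 2 * (1 - δ) := by
    simp; ring
  rw [this] at h2
  refine h2.congr' ?_
  filter_upwards [Ioo_mem_nhdsLT (show (0 : ℝ) < 1 by norm_num)] with z hz
  rw [criticalExp_eq_slope hz.1, Function.comp, slope_def_field]

lemma criticalExp_le (h0 : 0 < δ) (h1 : δ < 1 / 2) (hz : z ∈ Ioo (0 : ℝ) 1) :
    criticalExp δ z ≤ 2 * (1 - δ) := by
  refine ge_of_tendsto (tendsto_criticalExp h0 h1) ?_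
  filter_upwards [Ioo_mem_nhdsLT hz.2] with w hw
  exact criticalExp_monotoneOn h0 h1 hz ⟨hz.1.trans hw.1, hw.2⟩ hw.1.le

lemma one_lt_criticalExp (h0 : 0 < δ) (h1 : δ < 1 / 2) (hz : z ∈ Ioo (0 : ℝ) 1) :
    1 < criticalExp δ z := by
  unfold criticalExp
  have := div_pos_of_neg_of_neg (logRatio_neg h0 h1 hz) (log_neg hz.1 hz.2)
  linarith

lemma one_sub_couplingBias (h0 : 0 < δ) (h1 : δ < 1 / 2) (hz : 0 ≤ z) :
    1 - couplingBias δ z = ((1 - δ) + δ * z) / couplingMass δ z := by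
  have := couplingMass_pos h0 h1 hz
  rw [couplingBias, eq_div_iff this.ne', sub_mul, div_mul_cancel₀ _ this.ne', couplingMass]
  ring

lemma couplingBias_nonneg (h0 : 0 < δ) (h1 : δ < 1 / 2) (hz : 0 ≤ z) :
    0 ≤ couplingBias δ z := by
  have := couplingMass_pos h0 h1 hz
  have : 0 < 1 - δ := by linarith
  unfold couplingBias; positivity

lemma couplingBias_pos (h0 : 0 < δ) (h1 : δ < 1 / 2) (hz : 0 < z) :
    0 < couplingBias δ z := by
  have := couplingMass_pos h0 h1 hz.le
  have : 0 < 1 - δ := by linarith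
  unfold couplingBias; positivity

lemma couplingBias_le_half (h0 : 0 < δ) (h1 : δ < 1 / 2) (hz : z ∈ Icc (0 : ℝ) 1) :
    couplingBias δ z ≤ 1 / 2 := by
  obtain ⟨hz0, hz1⟩ := hz
  have := couplingMass_pos h0 h1 hz0
  have h2 : 0 ≤ (1 - δ) * ((1 - z) * (1 + z)) :=
    mul_nonneg (by linarith) (mul_nonneg (by linarith) (by linarith))
  rw [couplingBias, div_le_iff₀ this, couplingMass]
  linarith

lemma couplingBias_lt_half (h0 : 0 < δ) (h1 : δ < 1 / 2) (hz : z ∈ Ico (0 : ℝ) 1) :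
    couplingBias δ z < 1 / 2 := by
  obtain ⟨hz0, hz1⟩ := hz
  have := couplingMass_pos h0 h1 hz0
  have h2 : 0 < (1 - δ) * ((1 - z) * (1 + z)) :=
    mul_pos (by linarith) (mul_pos (by linarith) (by linarith))
  rw [couplingBias, div_lt_iff₀ this, couplingMass]
  linarith

lemma couplingBias_zero (δ : ℝ) : couplingBias δ 0 = 0 := by simp [couplingBias]

lemma couplingBias_one (δ : ℝ) : couplingBias δ 1 = 1 / 2 := by
  unfold couplingBias couplingMass; ring_nf

lemma hasDerivAt_couplingMass (δ z : ℝ) :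
    HasDerivAt (couplingMass δ) (2 * (δ + (1 - δ) * z)) z := by
  have h := (((hasDerivAt_pow 2 z).const_add 1).const_mul (1 - δ)).add
    ((hasDerivAt_id z).const_mul (2 * δ))
  refine h.congr_deriv ?_
  simp; ring

lemma continuousOn_couplingBias (h0 : 0 < δ) (h1 : δ < 1 / 2) :
    ContinuousOn (couplingBias δ) (Ici 0) := by
  refine ContinuousOn.div (by fun_prop) ?_ (fun z hz => (couplingMass_pos h0 h1 hz).ne')
  unfold couplingMass; fun_prop

/-- The derivative of `couplingBias`. -/
def couplingBiasDeriv (δ z : ℝ) : ℝ :=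
  (δ * (1 - δ) + 2 * (1 - δ) ^ 2 * z + δ * (1 - δ) * z ^ 2) / couplingMass δ z ^ 2

lemma couplingBiasDeriv_pos (h0 : 0 < δ) (h1 : δ < 1 / 2) (hz : 0 ≤ z) :
    0 < couplingBiasDeriv δ z := by
  have := couplingMass_pos h0 h1 hz
  have : 0 < 1 - δ := by linarith
  unfold couplingBiasDeriv; positivity

lemma hasDerivAt_couplingBias (h0 : 0 < δ) (h1 : δ < 1 / 2) (hz : 0 ≤ z) :
    HasDerivAt (couplingBias δ) (couplingBiasDeriv δ z) z := by
  have hD := couplingMass_pos h0 h1 hz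
  have h := ((hasDerivAt_id z).mul (((hasDerivAt_id z).const_mul (1 - δ)).const_add δ)).div
    (hasDerivAt_couplingMass δ z) hD.ne'
  refine h.congr_deriv ?_
  rw [couplingBiasDeriv]
  congr 1
  simp [couplingMass]; ring

/-- The odds of the marginal are `z^p` with `p` the critical exponent. This makes the entropy change
`p` times as fast as `phiParam`. -/
lemma log_couplingBias_sub (h0 : 0 < δ) (h1 : δ < 1 / 2) (hz : z ∈ Ioo (0 : ℝ) 1) :
    log (couplingBias δ z) - log (1 - couplingBias δ z) = criticalExp δ z * log z := by
  have hD := couplingMass_pos h0 h1 hz.1.le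
  have ha : 0 < 1 - δ := by linarith
  have hz0 := hz.1
  have h2 : 0 < δ + (1 - δ) * z := by positivity
  have h3 : 0 < (1 - δ) + δ * z := by positivity
  have hl := (log_neg hz.1 hz.2).ne
  rw [one_sub_couplingBias h0 h1 hz0.le, couplingBias, log_div (by positivity) hD.ne',
    log_div h3.ne' hD.ne', log_mul hz0.ne' h2.ne', criticalExp, logRatio]
  field_simp
  ring

lemma hasDerivAt_entropyParam (h0 : 0 < δ) (h1 : δ < 1 / 2) (hz : z ∈ Ioo (0 : ℝ) 1) :
    HasDerivAt (entropyParam δ)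
      (-(criticalExp δ z * log z) * couplingBiasDeriv δ z / log 2) z := by
  have hb := couplingBias_pos h0 h1 hz.1
  have hb' := couplingBias_lt_half h0 h1 ⟨hz.1.le, hz.2⟩
  have h := ((Real.hasDerivAt_binEntropy hb.ne' (by linarith)).comp z
    (hasDerivAt_couplingBias h0 h1 hz.1.le)).div_const (log 2)
  refine h.congr_deriv ?_
  rw [← log_couplingBias_sub h0 h1 hz]
  ring

/-- Half the logarithmic derivative of the mass is `couplingBias / z`, which cancels the term from
differentiating `log z`. Dividing by the derivative of the entropy leaves `1 / criticalExp`. -/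
lemma hasDerivAt_phiParam (h0 : 0 < δ) (h1 : δ < 1 / 2) (hz : z ∈ Ioo (0 : ℝ) 1) :
    HasDerivAt (phiParam δ) (-log z * couplingBiasDeriv δ z / log 2) z := by
  have hD := couplingMass_pos h0 h1 hz.1.le
  have h := (((((hasDerivAt_couplingMass δ z).div_const 2).log (by positivity)).div_const 2).sub
    ((hasDerivAt_couplingBias h0 h1 hz.1.le).mul (Real.hasDerivAt_log hz.1.ne'))).div_const (log 2)
  refine h.congr_deriv ?_
  congr 1
  have hz0 := hz.1.ne'
  rw [couplingBias]
  field_simp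
  ring

lemma continuousOn_entropyParam (h0 : 0 < δ) (h1 : δ < 1 / 2) :
    ContinuousOn (entropyParam δ) (Ici 0) := by
  unfold entropyParam H
  exact (Real.binEntropy_continuous.comp_continuousOn (continuousOn_couplingBias h0 h1)).div_const _

lemma continuousOn_phiParam (h0 : 0 < δ) (h1 : δ < 1 / 2) :
    ContinuousOn (phiParam δ) (Ici 0) := by
  have hne : ∀ z ∈ Ici (0 : ℝ), couplingMass δ z ≠ 0 := fun z hz => (couplingMass_pos h0 h1 hz).ne'
  have hc : ContinuousOn (couplingMass δ) (Ici 0) := by unfold couplingMass; fun_prop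
  -- The factor `z` of the bias is moved to the logarithm, since `z log z` is continuous at 0 and
  -- `log z` is not.
  have h : ContinuousOn (fun z => (log (couplingMass δ z / 2) / 2 -
      (δ + (1 - δ) * z) / couplingMass δ z * (z * log z)) / log 2) (Ici 0) := by
    refine ContinuousOn.div_const (ContinuousOn.sub ?_ ?_) _
    · exact ((hc.div_const 2).log (fun z hz => div_ne_zero (hne z hz) two_ne_zero)).div_const _
    · exact (ContinuousOn.div (by fun_prop) hc hne).mul Real.continuous_mul_log.continuousOn
  refine h.congr (fun z _ => ?_)
  unfold phiParam couplingBias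
  ring

lemma entropyParam_zero (δ : ℝ) : entropyParam δ 0 = 0 := by
  simp [entropyParam, couplingBias_zero, H]

lemma entropyParam_one (δ : ℝ) : entropyParam δ 1 = 1 := by
  have : log 2 ≠ 0 := (log_pos one_lt_two).ne'
  rw [entropyParam, couplingBias_one, H, one_div, Real.binEntropy_two_inv, div_self this]

lemma phiParam_one (δ : ℝ) : phiParam δ 1 = 0 := by
  have : couplingMass δ 1 = 2 := by unfold couplingMass; ring
  simp [phiParam, this]

lemma entropyParam_strictMonoOn (h0 : 0 < δ) (h1 : δ < 1 / 2) :
    StrictMonoOn (entropyParam δ) (Icc 0 1) := by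
  refine strictMonoOn_of_deriv_pos (convex_Icc 0 1)
    ((continuousOn_entropyParam h0 h1).mono Icc_subset_Ici_self) ?_
  intro z hz
  rw [interior_Icc] at hz
  rw [(hasDerivAt_entropyParam h0 h1 hz).deriv]
  have := one_lt_criticalExp h0 h1 hz
  have h2 := log_neg hz.1 hz.2
  have h3 := couplingBiasDeriv_pos h0 h1 hz.1.le
  have h4 := log_pos one_lt_two
  have h5 : 0 < -(criticalExp δ z * log z) := by nlinarith
  positivity

lemma phiParam_monotoneOn (h0 : 0 < δ) (h1 : δ < 1 / 2) :
    MonotoneOn (phiParam δ) (Icc 0 1) := by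
  refine monotoneOn_of_deriv_nonneg (convex_Icc 0 1)
    ((continuousOn_phiParam h0 h1).mono Icc_subset_Ici_self) ?_ ?_
  · rw [interior_Icc]
    exact fun z hz => (hasDerivAt_phiParam h0 h1 hz).differentiableAt.differentiableWithinAt
  · intro z hz
    rw [interior_Icc] at hz
    rw [(hasDerivAt_phiParam h0 h1 hz).deriv]
    have h2 : 0 < -log z := neg_pos.2 (log_neg hz.1 hz.2)
    have h3 := couplingBiasDeriv_pos h0 h1 hz.1.le
    have h4 := log_pos one_lt_two
    positivity

/-- The curve `(entropyParam, phiParam)` lies below its tangents. -/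
lemma phiParam_le_tangent (h0 : 0 < δ) (h1 : δ < 1 / 2) {w : ℝ} (hw : w ∈ Ioo (0 : ℝ) 1)
    (hz : z ∈ Icc (0 : ℝ) 1) :
    phiParam δ z ≤
      phiParam δ w + (entropyParam δ z - entropyParam δ w) / criticalExp δ w := by
  have hp : 0 < criticalExp δ w := zero_lt_one.trans (one_lt_criticalExp h0 h1 hw)
  set F : ℝ → ℝ := fun z => phiParam δ z - entropyParam δ z / criticalExp δ w with hF
  have hcont : ContinuousOn F (Ici 0) :=
    (continuousOn_phiParam h0 h1).sub ((continuousOn_entropyParam h0 h1).div_const _)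
  -- The derivative is a nonnegative factor times `p(w) - p(z)`, so monotonicity of the critical
  -- exponent puts the maximum of `F` at `w`.
  have hderiv : ∀ z ∈ Ioo (0 : ℝ) 1, HasDerivAt F
      ((-log z) * couplingBiasDeriv δ z / log 2 / criticalExp δ w
        * (criticalExp δ w - criticalExp δ z)) z := by
    intro z hz
    have := (hasDerivAt_phiParam h0 h1 hz).sub
      ((hasDerivAt_entropyParam h0 h1 hz).div_const (criticalExp δ w))
    refine this.congr_deriv ?_
    have h4 := (log_pos one_lt_two).ne'
    field_simp
    ring
  have hpos : ∀ z ∈ Ioo (0 : ℝ) 1,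
      0 ≤ (-log z) * couplingBiasDeriv δ z / log 2 / criticalExp δ w := by
    intro z hz
    have h2 : 0 < -log z := neg_pos.2 (log_neg hz.1 hz.2)
    have h3 := couplingBiasDeriv_pos h0 h1 hz.1.le
    have h4 := log_pos one_lt_two
    positivity
  have key : F z ≤ F w := by
    rcases le_total z w with h | h
    · refine monotoneOn_of_deriv_nonneg (convex_Icc 0 w) (hcont.mono Icc_subset_Ici_self) ?_ ?_
        ⟨hz.1, h⟩ ⟨hw.1.le, le_rfl⟩ h
      · rw [interior_Icc]
        exact fun x hx => (hderiv x ⟨hx.1, hx.2.trans hw.2⟩).differentiableAt.differentiableWithinAt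
      · rw [interior_Icc]
        intro x hx
        have hx' : x ∈ Ioo (0 : ℝ) 1 := ⟨hx.1, hx.2.trans hw.2⟩
        rw [(hderiv x hx').deriv]
        exact mul_nonneg (hpos x hx') (sub_nonneg.2 (criticalExp_monotoneOn h0 h1 hx' hw hx.2.le))
    · refine antitoneOn_of_deriv_nonpos (convex_Icc w 1)
        (hcont.mono (fun x hx => hw.1.le.trans hx.1)) ?_ ?_ ⟨le_rfl, hw.2.le⟩ ⟨h, hz.2⟩ h
      · rw [interior_Icc]
        exact fun x hx => (hderiv x ⟨hw.1.trans hx.1, hx.2⟩).differentiableAt.differentiableWithinAt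
      · rw [interior_Icc]
        intro x hx
        have hx' : x ∈ Ioo (0 : ℝ) 1 := ⟨hw.1.trans hx.1, hx.2⟩
        rw [(hderiv x hx').deriv]
        exact mul_nonpos_of_nonneg_of_nonpos (hpos x hx')
          (sub_nonpos.2 (criticalExp_monotoneOn h0 h1 hw hx' hx.1.le))
  simp only [hF] at key
  rw [sub_div]
  linarith

end Parametrization

/-! ### Two-point inequalities at the critical exponents. -/

/-- The one-dimensional inequality `‖T f‖₂ ≤ C ‖f‖_p` for nonnegative `f = (u, v)`. -/
def TwoPoint (δ p C : ℝ) : Prop :=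
  ∀ u v : ℝ, 0 ≤ u → 0 ≤ v →
    (1 - δ) * (u ^ 2 + v ^ 2) + 2 * δ * (u * v) ≤ 2 * C ^ 2 * ((u ^ p + v ^ p) / 2) ^ (2 / p)

/-- Both sides are symmetric and homogeneous of degree two, so the larger value can be scaled to 1.
-/
lemma TwoPoint.of_unit {δ p C : ℝ} (hp : 0 < p)
    (h : ∀ t ∈ Icc (0 : ℝ) 1, couplingMass δ t ≤ 2 * C ^ 2 * ((1 + t ^ p) / 2) ^ (2 / p)) :
    TwoPoint δ p C := by
  have key : ∀ u v : ℝ, 0 < u → 0 ≤ v → v ≤ u →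
      (1 - δ) * (u ^ 2 + v ^ 2) + 2 * δ * (u * v) ≤
        2 * C ^ 2 * ((u ^ p + v ^ p) / 2) ^ (2 / p) := by
    intro u v hu hv hvu
    have ht := h (v / u) ⟨by positivity, (div_le_one hu).2 hvu⟩
    have h1 : (u ^ p + v ^ p) / 2 = u ^ p * ((1 + (v / u) ^ p) / 2) := by
      rw [div_rpow hv hu.le]
      have := (rpow_pos_of_pos hu p).ne'
      field_simp
    have h2 : (u ^ p) ^ (2 / p) = u ^ 2 := by
      rw [← rpow_mul hu.le, mul_div_cancel₀ _ hp.ne']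
      exact rpow_natCast u 2
    rw [h1, mul_rpow (by positivity) (by positivity), h2]
    have h3 : (1 - δ) * (u ^ 2 + v ^ 2) + 2 * δ * (u * v) = u ^ 2 * couplingMass δ (v / u) := by
      unfold couplingMass
      field_simp
    rw [h3]
    nlinarith [mul_le_mul_of_nonneg_left ht (sq_nonneg u)]
  intro u v hu hv
  rcases hu.eq_or_lt with rfl | hu'
  · rcases hv.eq_or_lt with rfl | hv'
    · have : 0 ≤ ((0 : ℝ) ^ p + 0 ^ p) / 2 := by positivity
      simp only [mul_zero, add_zero, ne_eq, OfNat.ofNat_ne_zero, not_false_eq_true, zero_pow]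
      positivity
    · have := key v 0 hv' le_rfl hv
      rwa [add_comm (v ^ 2), mul_comm v, add_comm (v ^ p)] at this
  · rcases le_total v u with h | h
    · exact key u v hu' hv h
    · have := key v u (hu'.trans_le h) hu h
      rwa [add_comm (v ^ 2), mul_comm v, add_comm (v ^ p)] at this

section Parametrization

variable {δ z : ℝ}

lemma one_sub_couplingBias_eq_inv (h0 : 0 < δ) (h1 : δ < 1 / 2) (hz : z ∈ Ioo (0 : ℝ) 1) :
    1 - couplingBias δ z = (1 + z ^ criticalExp δ z)⁻¹ := by
  have h := log_couplingBias_sub h0 h1 hz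
  have hb := couplingBias_pos h0 h1 hz.1
  have hb' := couplingBias_lt_half h0 h1 ⟨hz.1.le, hz.2⟩
  have hb2 : 0 < 1 - couplingBias δ z := by linarith
  rw [← log_div hb.ne' hb2.ne'] at h
  have h2 : z ^ criticalExp δ z = couplingBias δ z / (1 - couplingBias δ z) := by
    rw [rpow_def_of_pos hz.1, mul_comm, ← h, exp_log (by positivity)]
  rw [h2]
  field_simp
  ring

/-- Up to constants the difference is the logarithm of `‖T f‖₂ / ‖f‖_p` at `f = (1, z)`. Its
derivative has the sign of `p - criticalExp δ z`, so `w` is a maximum. -/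
lemma log_couplingMass_sub_le (h0 : 0 < δ) (h1 : δ < 1 / 2) {w : ℝ} (hw : w ∈ Ioo (0 : ℝ) 1)
    (hz : z ∈ Icc (0 : ℝ) 1) :
    log (couplingMass δ z) / 2 - log (1 + z ^ criticalExp δ w) / criticalExp δ w ≤
      log (couplingMass δ w) / 2 - log (1 + w ^ criticalExp δ w) / criticalExp δ w := by
  set p := criticalExp δ w with hpdef
  have hp1 : 1 < p := one_lt_criticalExp h0 h1 hw
  have hp : 0 < p := zero_lt_one.trans hp1
  have ha : 0 < 1 - δ := by linarith
  set F : ℝ → ℝ := fun z => log (couplingMass δ z) / 2 - log (1 + z ^ p) / p with hF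
  have hcont : ContinuousOn F (Ici 0) := by
    refine ContinuousOn.sub (ContinuousOn.div_const (ContinuousOn.log ?_
      (fun z hz => (couplingMass_pos h0 h1 hz).ne')) _) (ContinuousOn.div_const
        (ContinuousOn.log ?_ (fun z hz => ?_)) _)
    · unfold couplingMass; fun_prop
    · exact continuousOn_const.add (continuousOn_id.rpow_const (fun _ _ => Or.inr hp.le))
    · have := rpow_nonneg (show (0 : ℝ) ≤ z from hz) p
      positivity
  have hderiv : ∀ z ∈ Ioo (0 : ℝ) 1, HasDerivAt F
      (((δ + (1 - δ) * z) - z ^ (p - 1) * ((1 - δ) + δ * z)) /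
        (couplingMass δ z * (1 + z ^ p))) z := by
    intro z hz
    have hz0 := hz.1
    have hD := couplingMass_pos h0 h1 hz.1.le
    have hzp := rpow_pos_of_pos hz0 p
    have hzp' := rpow_pos_of_pos hz0 (p - 1)
    have := (((hasDerivAt_couplingMass δ z).log hD.ne').div_const 2).sub
      ((((Real.hasDerivAt_rpow_const (Or.inl hz0.ne')).const_add 1).log
        (show 1 + z ^ p ≠ 0 by positivity)).div_const p)
    refine this.congr_deriv ?_
    have e : z ^ p = z * z ^ (p - 1) := by
      rw [rpow_sub_one hz0.ne']; field_simp
    rw [e] at *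
    field_simp
    unfold couplingMass
    ring
  have hsign : ∀ z ∈ Ioo (0 : ℝ) 1, (criticalExp δ z ≤ p ↔
      0 ≤ (δ + (1 - δ) * z) - z ^ (p - 1) * ((1 - δ) + δ * z)) := by
    intro z hz
    have hz0 := hz.1
    have h3 : 0 < (1 - δ) + δ * z := by positivity
    have h2 : 0 < δ + (1 - δ) * z := by positivity
    rw [sub_nonneg, ← le_div_iff₀ h3, ← log_le_log_iff (rpow_pos_of_pos hz0 _) (by positivity),
      log_rpow hz0, log_div h2.ne' h3.ne', ← logRatio, criticalExp,
      ← div_le_iff_of_neg (log_neg hz.1 hz.2)]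
    constructor <;> intro h <;> linarith
  have key : F z ≤ F w := by
    rcases le_total z w with h | h
    · refine monotoneOn_of_deriv_nonneg (convex_Icc 0 w) (hcont.mono Icc_subset_Ici_self) ?_ ?_
        ⟨hz.1, h⟩ ⟨hw.1.le, le_rfl⟩ h
      · rw [interior_Icc]
        exact fun x hx => (hderiv x ⟨hx.1, hx.2.trans hw.2⟩).differentiableAt.differentiableWithinAt
      · rw [interior_Icc]
        intro x hx
        have hx' : x ∈ Ioo (0 : ℝ) 1 := ⟨hx.1, hx.2.trans hw.2⟩
        rw [(hderiv x hx').deriv]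
        have := (hsign x hx').1 (criticalExp_monotoneOn h0 h1 hx' hw hx.2.le)
        have hD := couplingMass_pos h0 h1 hx.1.le
        have := rpow_pos_of_pos hx.1 p
        positivity
    · refine antitoneOn_of_deriv_nonpos (convex_Icc w 1)
        (hcont.mono (fun x hx => hw.1.le.trans hx.1)) ?_ ?_ ⟨le_rfl, hw.2.le⟩ ⟨h, hz.2⟩ h
      · rw [interior_Icc]
        exact fun x hx => (hderiv x ⟨hw.1.trans hx.1, hx.2⟩).differentiableAt.differentiableWithinAt
      · rw [interior_Icc]
        intro x hx
        have hx' : x ∈ Ioo (0 : ℝ) 1 := ⟨hw.1.trans hx.1, hx.2⟩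
        rw [(hderiv x hx').deriv]
        have hD := couplingMass_pos h0 h1 hx'.1.le
        have hxp := rpow_pos_of_pos hx'.1 p
        refine div_nonpos_of_nonpos_of_nonneg ?_ (by positivity)
        -- `hsign` makes the numerator negative only when the exponent strictly exceeds `p`; when
        -- the exponents agree the numerator vanishes.
        rcases (criticalExp_monotoneOn h0 h1 hw hx' hx.1.le).eq_or_lt with he | hlt
        · have h3 : 0 < (1 - δ) + δ * x := by have := hx'.1; positivity
          have h2 : 0 < δ + (1 - δ) * x := by have := hx'.1; positivity
          have : x ^ (p - 1) = (δ + (1 - δ) * x) / ((1 - δ) + δ * x) := by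
            rw [rpow_def_of_pos hx'.1, ← exp_log (show 0 < (δ + (1 - δ) * x) / ((1 - δ) + δ * x)
              by positivity), log_div h2.ne' h3.ne', ← logRatio, hpdef, he, criticalExp]
            congr 1
            have := (log_neg hx'.1 hx'.2).ne
            field_simp
            ring
          rw [this]
          field_simp
          simp
        · exact (lt_of_not_ge (fun h => hlt.not_ge ((hsign x hx').2 h))).le
  exact key

/-- The multiplicative constant of the tangent at the parameter `z`. -/
lemma log_tangentConst (h0 : 0 < δ) (h1 : δ < 1 / 2) (hz : z ∈ Ioo (0 : ℝ) 1) :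
    (phiParam δ z + (1 - entropyParam δ z) / criticalExp δ z) * log 2 =
      log (couplingMass δ z / 2) / 2 +
        (log 2 - log (1 + z ^ criticalExp δ z)) / criticalExp δ z := by
  have hp := zero_lt_one.trans (one_lt_criticalExp h0 h1 hz)
  have h := log_couplingBias_sub h0 h1 hz
  have h2 := one_sub_couplingBias_eq_inv h0 h1 hz
  have h3 : log (1 - couplingBias δ z) = - log (1 + z ^ criticalExp δ z) := by rw [h2, log_inv]
  have hl := log_pos one_lt_two
  have h4 : binEntropy (couplingBias δ z) =
      -couplingBias δ z * (criticalExp δ z * log z) + log (1 + z ^ criticalExp δ z) := by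
    rw [Real.binEntropy, log_inv, log_inv]
    rw [h3] at h ⊢
    rw [eq_add_of_sub_eq h]
    ring
  rw [phiParam, entropyParam, H, h4]
  field_simp
  ring

/-- The ratio of norms is maximal at `(1, z)`, and by `log_tangentConst` its logarithm there is the
value at abscissa 1 of the tangent to the curve. -/
lemma twoPoint_criticalExp (h0 : 0 < δ) (h1 : δ < 1 / 2) (hz : z ∈ Ioo (0 : ℝ) 1) :
    TwoPoint δ (criticalExp δ z)
      (2 ^ (phiParam δ z + (1 - entropyParam δ z) / criticalExp δ z)) := by
  have hp := zero_lt_one.trans (one_lt_criticalExp h0 h1 hz)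
  refine TwoPoint.of_unit hp (fun t ht => ?_)
  have hl := log_tangentConst h0 h1 hz
  have hm := log_couplingMass_sub_le h0 h1 hz ht
  set p := criticalExp δ z
  have hD := couplingMass_pos h0 h1 hz.1.le
  have hDt := couplingMass_pos h0 h1 ht.1
  have htp := rpow_nonneg ht.1 p
  have hpos : (0 : ℝ) < 2 ^ (phiParam δ z + (1 - entropyParam δ z) / p) := by positivity
  rw [← log_le_log_iff hDt (by positivity), log_mul (by positivity) (by positivity),
    log_mul (by positivity) (by positivity), log_pow, log_rpow two_pos, hl,
    log_rpow (by positivity), log_div hD.ne' two_ne_zero, log_div (by positivity) two_ne_zero]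
  push_cast
  have e : 2 / p * (log (1 + t ^ p) - log 2) = 2 * ((log (1 + t ^ p)) / p - log 2 / p) := by ring
  rw [e, sub_div, sub_div (log 2)]
  linarith

lemma phiParam_zero (δ : ℝ) : phiParam δ 0 = log ((1 - δ) / 2) / 2 / log 2 := by
  simp [phiParam, couplingMass]

/-- The endpoint `z = 0`, where the exponent degenerates to 1. The claim reduces to `(1-δ)(1+t²) +
2δt ≤ (1-δ)(1+t)²`, true because `δ ≤ 1-δ`. -/
lemma twoPoint_one (h1 : δ ≤ 1 / 2) :
    TwoPoint δ 1 (2 ^ (phiParam δ 0 + 1)) := by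
  refine TwoPoint.of_unit one_pos (fun t ht => ?_)
  have ha : 0 < 1 - δ := by linarith
  have hC : ((2 : ℝ) ^ (phiParam δ 0 + 1)) ^ 2 = 2 * (1 - δ) := by
    have hl := (log_pos one_lt_two).ne'
    rw [← log_injOn_pos.eq_iff (show _ ∈ Ioi (0 : ℝ) from by simp only [mem_Ioi]; positivity)
      (show _ ∈ Ioi (0 : ℝ) from by simp only [mem_Ioi]; positivity), log_pow, log_rpow two_pos,
      phiParam_zero, log_mul two_ne_zero ha.ne', log_div ha.ne' two_ne_zero]
    field_simp
    push_cast
    ring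
  rw [hC, rpow_one, div_one, rpow_two, couplingMass]
  nlinarith [ht.1]

/-! ### Identification of `Φ` with the parametrized curve. -/

lemma H_strictMonoOn : StrictMonoOn H (Icc 0 (1 / 2)) := by
  intro x hx y hy hxy
  have := Real.binEntropy_strictMonoOn (by simpa using hx) (by simpa using hy) hxy
  exact div_lt_div_of_pos_right this (log_pos one_lt_two)

lemma Hinv_H {s : ℝ} (hs : s ∈ Icc (0 : ℝ) (1 / 2)) : Hinv (H s) = s :=
  H_strictMonoOn.injOn.leftInvOn_invFunOn hs

lemma H_zero : H 0 = 0 := by simp [H]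

lemma H_half : H (1 / 2) = 1 := by
  have : log 2 ≠ 0 := (log_pos one_lt_two).ne'
  rw [H, one_div, Real.binEntropy_two_inv, div_self this]

lemma exists_H_eq {x : ℝ} (hx : x ∈ Icc (0 : ℝ) 1) : ∃ s ∈ Icc (0 : ℝ) (1 / 2), H s = x := by
  have : ContinuousOn H (Icc 0 (1 / 2)) := (Real.binEntropy_continuous.div_const _).continuousOn
  have := intermediate_value_Icc (by norm_num) this
  rw [H_zero, H_half] at this
  exact this hx

/-- `yAux` is the probability of one mixed pair under the normalized coupling. In terms of `z` the
expression under the square root is a perfect square. -/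
lemma yAux_entropyParam (h0 : 0 < δ) (h1 : δ < 1 / 2) (hz : z ∈ Icc (0 : ℝ) 1) :
    yAux (entropyParam δ z) δ = δ * z / couplingMass δ z := by
  have hD := couplingMass_pos h0 h1 hz.1
  have hz0 := hz.1
  have hρ : 0 < 1 - 2 * δ := by linarith
  rw [yAux, if_neg h1.ne, entropyParam,
    Hinv_H ⟨couplingBias_nonneg h0 h1 hz.1, couplingBias_le_half h0 h1 hz⟩,
    one_sub_couplingBias h0 h1 hz.1, couplingBias]
  have hs : δ ^ 2 + 4 * (1 - 2 * δ) * (z * (δ + (1 - δ) * z) / couplingMass δ z *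
      ((1 - δ + δ * z) / couplingMass δ z)) =
      (δ + 2 * (1 - 2 * δ) * z / couplingMass δ z) ^ 2 := by
    field_simp
    unfold couplingMass
    ring
  have hρ' := hρ.ne'
  rw [hs, sqrt_sq (by positivity)]
  generalize couplingMass δ z = D at *
  rw [div_eq_iff (by positivity)]
  field_simp
  ring

/-- The two ratios inside `H` are conditional probabilities of the coupling. Once every logarithm is
split into logarithms of the five basic quantities, a rational identity remains; `z = 0` is separate
and uses the conventions at zero. -/
lemma Phi_entropyParam (h0 : 0 < δ) (h1 : δ < 1 / 2) (hz : z ∈ Icc (0 : ℝ) 1) :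
    Phi (entropyParam δ z) δ = phiParam δ z := by
  have hl := (log_pos one_lt_two).ne'
  have ha : 0 < 1 - δ := by linarith
  rw [Phi, yAux_entropyParam h0 h1 hz]
  have hinv : Hinv (entropyParam δ z) = couplingBias δ z :=
    Hinv_H ⟨couplingBias_nonneg h0 h1 hz.1, couplingBias_le_half h0 h1 hz⟩
  rw [hinv, Real.logb, Real.logb]
  rcases hz.1.eq_or_lt with rfl | hz0
  · rw [couplingBias_zero, phiParam_zero, entropyParam_zero, log_div ha.ne' two_ne_zero]
    simp [H_zero]
    field_simp
    ring
  have hD := couplingMass_pos h0 h1 hz.1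
  have hm : 0 < δ + (1 - δ) * z := by positivity
  have hk : 0 < (1 - δ) + δ * z := by positivity
  have e1 : δ * z / couplingMass δ z / couplingBias δ z = δ / (δ + (1 - δ) * z) := by
    rw [couplingBias]; field_simp
  have e2 : δ * z / couplingMass δ z / (1 - couplingBias δ z) = δ * z / ((1 - δ) + δ * z) := by
    rw [one_sub_couplingBias h0 h1 hz.1]; field_simp
  have e3 : 1 - δ / (δ + (1 - δ) * z) = (1 - δ) * z / (δ + (1 - δ) * z) := by
    field_simp; ring
  have e4 : 1 - δ * z / ((1 - δ) + δ * z) = (1 - δ) / ((1 - δ) + δ * z) := by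
    field_simp; ring
  rw [e1, e2, entropyParam, H, H, H, binEntropy, binEntropy, binEntropy, e3, e4, phiParam,
    one_sub_couplingBias h0 h1 hz.1, couplingBias]
  simp only [log_inv]
  rw [log_div (by positivity) hD.ne', log_div hk.ne' hD.ne', log_mul hz0.ne' hm.ne',
    log_div h0.ne' hm.ne', log_div (by positivity) hm.ne', log_div (by positivity) hk.ne',
    log_div ha.ne' hk.ne', log_div hD.ne' two_ne_zero, log_mul h0.ne' hz0.ne',
    log_mul ha.ne' hz0.ne']
  generalize log z = lz
  generalize log δ = ld
  generalize log (1 - δ) = la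
  generalize log (δ + (1 - δ) * z) = lm
  generalize log ((1 - δ) + δ * z) = lk
  generalize log (couplingMass δ z) = lD
  field_simp
  unfold couplingMass
  ring

lemma exists_entropyParam_eq (h0 : 0 < δ) (h1 : δ < 1 / 2) {x : ℝ} (hx : x ∈ Icc (0 : ℝ) 1) :
    ∃ z ∈ Icc (0 : ℝ) 1, entropyParam δ z = x := by
  have := intermediate_value_Icc zero_le_one
    ((continuousOn_entropyParam h0 h1).mono Icc_subset_Ici_self)
  rw [entropyParam_zero, entropyParam_one] at this
  exact this hx

end Parametrization

/-! ### Concavity of `φ_ε` and the slopes of its chords to 1. -/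

section Exponent

variable {ε α : ℝ}

lemma delta_pos (hε : ε ∈ Ioo (0 : ℝ) (1 / 2)) : 0 < 2 * ε * (1 - ε) := by
  have := hε.1
  have : 0 < 1 - ε := by linarith [hε.2]
  positivity

lemma delta_lt_half (hε : ε ∈ Ioo (0 : ℝ) (1 / 2)) : 2 * ε * (1 - ε) < 1 / 2 := by
  have := hε.2
  nlinarith [sq_pos_of_pos (show 0 < 1 / 2 - ε by linarith)]

lemma q0_eq (ε : ℝ) : q0 ε = 2 * (1 - 2 * ε * (1 - ε)) := by
  unfold q0; ring

lemma one_le_q0 (ε : ℝ) : 1 ≤ q0 ε := by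
  unfold q0; nlinarith [sq_nonneg (1 - 2 * ε)]

lemma phi_entropyParam (hε : ε ∈ Ioo (0 : ℝ) (1 / 2)) {z : ℝ} (hz : z ∈ Icc (0 : ℝ) 1) :
    phi ε (entropyParam (2 * ε * (1 - ε)) z) = phiParam (2 * ε * (1 - ε)) z :=
  Phi_entropyParam (delta_pos hε) (delta_lt_half hε) hz

lemma phi_zero_left (x : ℝ) : phi 0 x = (x - 1) / 2 := by
  simp [phi, Phi, yAux, H_zero]
  ring

lemma phi_half_left {x : ℝ} (hx : x ∈ Icc (0 : ℝ) 1) : phi (1 / 2) x = x - 1 := by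
  obtain ⟨s, hs, rfl⟩ := exists_H_eq hx
  have e : (2 : ℝ) * (1 / 2) * (1 - 1 / 2) = 1 / 2 := by norm_num
  have hl := (log_pos one_lt_two).ne'
  have hlog : Real.logb 2 (1 / 2) = -1 := by
    rw [Real.logb, one_div, log_inv]
    field_simp
  have hlog' : Real.logb 2 (1 - 1 / 2) = -1 := by
    rw [← hlog]; norm_num
  rw [phi, e, Phi, yAux, if_pos rfl, Hinv_H hs, hlog, hlog']
  rcases hs.1.eq_or_lt with rfl | h0
  · norm_num [H_zero]
  · have h1 : 0 < 1 - s := by linarith [hs.2]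
    rw [mul_div_cancel_left₀ _ h0.ne', mul_div_cancel_right₀ _ h1.ne']
    have : H (1 - s) = H s := by rw [H, H, Real.binEntropy_one_sub]
    rw [this]
    ring

lemma phi_one (hε : ε ∈ Icc (0 : ℝ) (1 / 2)) : phi ε 1 = 0 := by
  rcases hε.1.eq_or_lt with rfl | h0
  · rw [phi_zero_left]; norm_num
  rcases hε.2.eq_or_lt with rfl | h1
  · rw [phi_half_left (by simp)]; norm_num
  · rw [← entropyParam_one (2 * ε * (1 - ε)), phi_entropyParam ⟨h0, h1⟩ (by simp), phiParam_one]

lemma phi_zero_gt (hε : ε ∈ Ico (0 : ℝ) (1 / 2)) : -1 < phi ε 0 := by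
  rcases hε.1.eq_or_lt with rfl | h0
  · rw [phi_zero_left]; norm_num
  have hε' : ε ∈ Ioo (0 : ℝ) (1 / 2) := ⟨h0, hε.2⟩
  have hd := delta_lt_half hε'
  have := phi_entropyParam hε' (z := 0) (by simp)
  rw [entropyParam_zero] at this
  rw [this, phiParam_zero]
  have hl := log_pos one_lt_two
  rw [lt_div_iff₀ hl, lt_div_iff₀ two_pos]
  have h4 : log (1 / 4) = -1 * log 2 * 2 := by
    rw [one_div, log_inv, show (4 : ℝ) = 2 ^ 2 by norm_num, log_pow]
    push_cast; ring
  rw [← h4]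
  exact log_lt_log (by norm_num) (by linarith)

lemma phi_nonpos (hε : ε ∈ Icc (0 : ℝ) (1 / 2)) (hα : α ∈ Ico (0 : ℝ) 1) : phi ε α ≤ 0 := by
  rcases hε.1.eq_or_lt with rfl | h0
  · rw [phi_zero_left]; linarith [hα.2]
  have hα' : α ∈ Icc (0 : ℝ) 1 := ⟨hα.1, hα.2.le⟩
  rcases hε.2.eq_or_lt with rfl | h1
  · rw [phi_half_left hα']; linarith [hα.2]
  have hε' : ε ∈ Ioo (0 : ℝ) (1 / 2) := ⟨h0, h1⟩
  have hd0 := delta_pos hε'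
  have hd1 := delta_lt_half hε'
  obtain ⟨z, hz, rfl⟩ := exists_entropyParam_eq hd0 hd1 hα'
  rw [phi_entropyParam hε' hz, ← phiParam_one (2 * ε * (1 - ε))]
  exact phiParam_monotoneOn hd0 hd1 hz (by simp) hz.2

/-- The curve `φ_ε` has at each point of `[0, 1)` a supporting line from above, whose slope is the
inverse of an exponent for which the corresponding two-point inequality holds. -/
lemma exists_supporting_exponent (hε : ε ∈ Icc (0 : ℝ) (1 / 2)) (hα : α ∈ Ico (0 : ℝ) 1) :
    ∃ p, 1 ≤ p ∧ p ≤ q0 ε ∧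
      (∀ β ∈ Icc (0 : ℝ) 1, phi ε β ≤ phi ε α + (β - α) / p) ∧
      TwoPoint (2 * ε * (1 - ε)) p (2 ^ (phi ε α + (1 - α) / p)) := by
  rcases hε.1.eq_or_lt with rfl | h0
  -- At `ε = 0` the noise is trivial: the curve is a line of slope `1/2` and the constant is 1.
  · refine ⟨2, by norm_num, by norm_num [q0], fun β _ => ?_, ?_⟩
    · rw [phi_zero_left, phi_zero_left]; linarith
    · intro u v hu hv
      have e : (α - 1) / 2 + (1 - α) / 2 = 0 := by ring
      rw [phi_zero_left, e]
      norm_num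
      linarith
  rcases hε.2.eq_or_lt with rfl | h1
  -- At `ε = 1/2` the curve is a line of slope 1 and the noise is averaging, so the exponent is 1.
  · refine ⟨1, le_rfl, by norm_num [q0], fun β hβ => ?_, ?_⟩
    · rw [phi_half_left hβ, phi_half_left ⟨hα.1, hα.2.le⟩]; linarith
    · intro u v hu hv
      have e : α - 1 + (1 - α) / 1 = 0 := by ring
      rw [phi_half_left ⟨hα.1, hα.2.le⟩, e]
      norm_num
      nlinarith
  have hε' : ε ∈ Ioo (0 : ℝ) (1 / 2) := ⟨h0, h1⟩
  have hd0 := delta_pos hε'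
  have hd1 := delta_lt_half hε'
  rw [q0_eq]
  have hphi := fun z (hz : z ∈ Icc (0 : ℝ) 1) => phi_entropyParam hε' hz
  generalize 2 * ε * (1 - ε) = δ at *
  obtain ⟨z, hz, rfl⟩ := exists_entropyParam_eq hd0 hd1 (show α ∈ Icc (0 : ℝ) 1 from ⟨hα.1, hα.2.le⟩)
  have hz1 : z < 1 := lt_of_le_of_ne hz.2 (by
    rintro rfl; rw [entropyParam_one] at hα; exact lt_irrefl _ hα.2)
  rcases hz.1.eq_or_lt with rfl | hz0
  -- No critical exponent is available at `z = 0`. The supporting line of slope 1 is the limit of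
  -- the tangents at `t → 0+`, whose slopes are below 1.
  · refine ⟨1, le_rfl, by linarith, ?_, ?_⟩
    · intro β hβ
      obtain ⟨w, hw, rfl⟩ := exists_entropyParam_eq hd0 hd1 hβ
      rw [hphi w hw, hphi 0 hz, entropyParam_zero]
      rcases hw.1.eq_or_lt with rfl | hw0
      · rw [entropyParam_zero]; simp
      have hmem : Ioo 0 w ∈ 𝓝[>] (0 : ℝ) := Ioo_mem_nhdsGT hw0
      have ht : Tendsto (fun t => phiParam δ t + (entropyParam δ w - entropyParam δ t) / 1)
          (𝓝[>] 0) (𝓝 (phiParam δ 0 + (entropyParam δ w - 0) / 1)) := by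
        have h1 := ((continuousOn_phiParam hd0 hd1) 0 (by simp)).mono Ioi_subset_Ici_self
        have h2 := ((continuousOn_entropyParam hd0 hd1) 0 (by simp)).mono Ioi_subset_Ici_self
        have := h1.tendsto.add ((tendsto_const_nhds (x := entropyParam δ w)).sub h2.tendsto
          |>.div_const 1)
        rwa [entropyParam_zero] at this
      refine ge_of_tendsto ht ?_
      filter_upwards [hmem] with t htw
      have htI : t ∈ Ioo (0 : ℝ) 1 := ⟨htw.1, htw.2.trans_le hw.2⟩
      have hpt := one_lt_criticalExp hd0 hd1 htI
      refine (phiParam_le_tangent hd0 hd1 htI hw).trans ?_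
      have hmon := (entropyParam_strictMonoOn hd0 hd1).monotoneOn ⟨htI.1.le, htI.2.le⟩ hw htw.2.le
      gcongr
    · rw [hphi 0 hz, entropyParam_zero, sub_zero, div_one]
      exact twoPoint_one hd1.le
  · have hz' : z ∈ Ioo (0 : ℝ) 1 := ⟨hz0, hz1⟩
    refine ⟨criticalExp δ z, (one_lt_criticalExp hd0 hd1 hz').le, criticalExp_le hd0 hd1 hz', ?_, ?_⟩
    · intro β hβ
      obtain ⟨w, hw, rfl⟩ := exists_entropyParam_eq hd0 hd1 hβ
      rw [hphi w hw, hphi z hz]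
      exact phiParam_le_tangent hd0 hd1 hz' hw
    · rw [hphi z hz]
      exact twoPoint_criticalExp hd0 hd1 hz'

/-- The slope of the chord of `φ_ε` between `α` and `1`. -/
def chordSlope (ε α : ℝ) : ℝ := -phi ε α / (1 - α)

lemma phi_eq_chordSlope (hα : α < 1) : phi ε α = -((1 - α) * chordSlope ε α) := by
  have : 1 - α ≠ 0 := by linarith
  unfold chordSlope
  field_simp

/-- The supporting line is evaluated at 1, where `φ_ε` vanishes. -/
lemma chordSlope_le (hε : ε ∈ Icc (0 : ℝ) (1 / 2)) {p : ℝ} (hα : α ∈ Ico (0 : ℝ) 1)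
    (h : ∀ β ∈ Icc (0 : ℝ) 1, phi ε β ≤ phi ε α + (β - α) / p) : chordSlope ε α ≤ 1 / p := by
  have h1 := h 1 (by simp)
  have h2 : 0 < 1 - α := by linarith [hα.2]
  rw [phi_one hε] at h1
  rw [chordSlope, div_le_iff₀ h2, one_div, mul_comm, ← div_eq_mul_inv]
  linarith

/-- Concavity: the supporting line at the right-hand point is at least as steep as the chord from
there to 1, and it bounds `φ_ε` at the left-hand point. -/
lemma chordSlope_antitoneOn (hε : ε ∈ Icc (0 : ℝ) (1 / 2)) :
    AntitoneOn (chordSlope ε) (Ico 0 1) := by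
  intro β hβ α hα hβα
  obtain ⟨p, hp, -, ht, -⟩ := exists_supporting_exponent hε hα
  have h1 := chordSlope_le hε hα ht
  have h2 := ht β ⟨hβ.1, hβ.2.le⟩
  rw [phi_eq_chordSlope hα.2, phi_eq_chordSlope hβ.2] at h2
  have h3 : 0 < 1 - β := by linarith [hβ.2]
  have h4 : (α - β) * chordSlope ε α ≤ (α - β) * (1 / p) :=
    mul_le_mul_of_nonneg_left h1 (by linarith)
  have h5 : (β - α) / p = - ((α - β) * (1 / p)) := by ring
  rw [h5] at h2
  have : (1 - β) * chordSlope ε α ≤ (1 - β) * chordSlope ε β := by linarith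
  exact le_of_mul_le_mul_left this h3

/-- All supporting slopes lie in `[1/q₀, 1]`, which bounds every increment from both sides. -/
lemma phi_sub_mem (hε : ε ∈ Icc (0 : ℝ) (1 / 2)) {β : ℝ} (hβ : 0 ≤ β) (hβα : β ≤ α) (hα : α < 1) :
    phi ε β ≤ phi ε α - (α - β) / q0 ε ∧ phi ε α - (α - β) ≤ phi ε β := by
  constructor
  · obtain ⟨p, hp, hpq, ht, -⟩ := exists_supporting_exponent hε ⟨hβ.trans hβα, hα⟩
    have h2 := ht β ⟨hβ, hβα.trans hα.le⟩
    have : (α - β) / q0 ε ≤ (α - β) / p := by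
      gcongr
    have h5 : (β - α) / p = - ((α - β) / p) := by ring
    linarith
  · obtain ⟨p, hp, hpq, ht, -⟩ := exists_supporting_exponent hε ⟨hβ, hβα.trans_lt hα⟩
    have h2 := ht α ⟨hβ.trans hβα, hα.le⟩
    have : (α - β) / p ≤ (α - β) := div_le_self (by linarith) hp
    linarith

lemma continuousOn_phi (hε : ε ∈ Icc (0 : ℝ) (1 / 2)) : ContinuousOn (phi ε) (Ico 0 1) := by
  have hq : 0 < q0 ε := zero_lt_one.trans_le (one_le_q0 ε)
  have : LipschitzOnWith 1 (phi ε) (Ico 0 1) := by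
    refine LipschitzOnWith.of_dist_le_mul (fun x hx y hy => ?_)
    rw [NNReal.coe_one, one_mul, Real.dist_eq, Real.dist_eq]
    have key : ∀ x ∈ Ico (0 : ℝ) 1, ∀ y ∈ Ico (0 : ℝ) 1, x ≤ y → |phi ε x - phi ε y| ≤ |x - y| := by
      intro x hx y hy hxy
      obtain ⟨h1, h2⟩ := phi_sub_mem hε hx.1 hxy hy.2
      have : 0 ≤ (y - x) / q0 ε := div_nonneg (by linarith) hq.le
      rw [abs_of_nonpos (show x - y ≤ 0 by linarith), abs_le]
      constructor <;> linarith
    rcases le_total x y with h | h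
    · exact key x hx y hy h
    · rw [abs_sub_comm, abs_sub_comm x]
      exact key y hy x hx h
  exact this.continuousOn

lemma continuousOn_chordSlope (hε : ε ∈ Icc (0 : ℝ) (1 / 2)) :
    ContinuousOn (chordSlope ε) (Ico 0 1) :=
  (continuousOn_phi hε).neg.div (by fun_prop) (fun x hx => by
    have := hx.2
    simp only [ne_eq]; linarith)

/-- Increments up to `β < 1` have slope at least `1/q₀`. Letting `β → 1` needs only `φ(β) ≤ 0`, not
continuity at 1. -/
lemma inv_q0_le_chordSlope (hε : ε ∈ Icc (0 : ℝ) (1 / 2)) (hα : α ∈ Ico (0 : ℝ) 1) :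
    1 / q0 ε ≤ chordSlope ε α := by
  have h2 : 0 < 1 - α := by linarith [hα.2]
  rw [chordSlope, le_div_iff₀ h2]
  have ht : Tendsto (fun β => (0 : ℝ) - (β - α) / q0 ε) (𝓝[<] 1) (𝓝 (0 - (1 - α) / q0 ε)) := by
    have : Continuous (fun β => (0 : ℝ) - (β - α) / q0 ε) := by fun_prop
    exact (this.tendsto 1).mono_left nhdsWithin_le_nhds
  have : phi ε α ≤ 0 - (1 - α) / q0 ε := by
    refine ge_of_tendsto ht ?_
    filter_upwards [Ioo_mem_nhdsLT hα.2] with β hβ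
    have h1 := (phi_sub_mem hε hα.1 hβ.1.le hβ.2).1
    have hβ' : β ∈ Ico (0 : ℝ) 1 := ⟨hα.1.trans hβ.1.le, hβ.2⟩
    have h3 := phi_nonpos hε hβ'
    linarith
  linarith [this, show (1 : ℝ) / q0 ε * (1 - α) = (1 - α) / q0 ε by ring]

lemma chordSlope_pos (hε : ε ∈ Icc (0 : ℝ) (1 / 2)) (hα : α ∈ Ico (0 : ℝ) 1) :
    0 < chordSlope ε α :=
  (div_pos one_pos (zero_lt_one.trans_le (one_le_q0 ε))).trans_le (inv_q0_le_chordSlope hε hα)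

lemma chordSlope_le_one (hε : ε ∈ Icc (0 : ℝ) (1 / 2)) (hα : α ∈ Ico (0 : ℝ) 1) :
    chordSlope ε α ≤ 1 := by
  obtain ⟨p, hp, -, ht, -⟩ := exists_supporting_exponent hε hα
  exact (chordSlope_le hε hα ht).trans (by rw [div_le_one (by linarith)]; exact hp)

lemma chordSlope_lt_one (hε : ε ∈ Ico (0 : ℝ) (1 / 2)) (hα : α ∈ Ico (0 : ℝ) 1) :
    chordSlope ε α < 1 := by
  refine (chordSlope_antitoneOn ⟨hε.1, hε.2.le⟩ (by simp) hα hα.1).trans_lt ?_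
  have := phi_zero_gt hε
  rw [chordSlope, sub_zero, div_one]
  linarith

/-- The critical exponent tends to `q₀` as `z → 1`, and the chord slope is at most its inverse; so
`1/q₀` is the infimum of the chord slopes. -/
lemma exists_chordSlope_lt (hε : ε ∈ Icc (0 : ℝ) (1 / 2)) {c : ℝ} (hc : 1 / q0 ε < c) :
    ∃ α ∈ Ioo (0 : ℝ) 1, chordSlope ε α < c := by
  rcases hε.1.eq_or_lt with rfl | h0
  · refine ⟨1 / 2, by norm_num, ?_⟩
    rw [chordSlope, phi_zero_left]
    norm_num [q0] at hc ⊢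
    linarith
  rcases hε.2.eq_or_lt with rfl | h1
  · refine ⟨1 / 2, by norm_num, ?_⟩
    rw [chordSlope, phi_half_left (by norm_num)]
    norm_num [q0] at hc ⊢
    linarith
  have hε' : ε ∈ Ioo (0 : ℝ) (1 / 2) := ⟨h0, h1⟩
  have hd0 := delta_pos hε'
  have hd1 := delta_lt_half hε'
  have hq := zero_lt_one.trans_le (one_le_q0 ε)
  have hc0 : 0 < c := (div_pos one_pos hq).trans hc
  have h1c : 1 / c < q0 ε := by
    rw [div_lt_iff₀ hc0]; rwa [div_lt_iff₀ hq, mul_comm] at hc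
  rw [q0_eq] at h1c
  have hev := (tendsto_criticalExp hd0 hd1).eventually (lt_mem_nhds h1c)
  obtain ⟨z, hz1, hz⟩ := (hev.and (Ioo_mem_nhdsLT (show (0 : ℝ) < 1 by norm_num))).exists
  have hmono := entropyParam_strictMonoOn hd0 hd1
  have hzI : z ∈ Icc (0 : ℝ) 1 := ⟨hz.1.le, hz.2.le⟩
  have hα0 := hmono (by simp) hzI hz.1
  have hα1 := hmono hzI (by simp) hz.2
  rw [entropyParam_zero] at hα0
  rw [entropyParam_one] at hα1
  refine ⟨_, ⟨hα0, hα1⟩, ?_⟩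
  have hp := zero_lt_one.trans (one_lt_criticalExp hd0 hd1 hz)
  refine (chordSlope_le (p := criticalExp (2 * ε * (1 - ε)) z) hε ⟨hα0.le, hα1⟩ ?_).trans_lt ?_
  · intro β hβ
    obtain ⟨w, hw, rfl⟩ := exists_entropyParam_eq hd0 hd1 hβ
    rw [phi_entropyParam hε' hw, phi_entropyParam hε' hzI]
    exact phiParam_le_tangent hd0 hd1 hz hw
  · rw [div_lt_iff₀ hp]; rwa [div_lt_iff₀ hc0, mul_comm] at hz1

/-- The left side of the equation for `α₀`. -/
def alphaEq (ε α : ℝ) : ℝ := 1 - α + α * chordSlope ε α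

lemma isAlpha0_iff {y : ℝ} : IsAlpha0 ε y α ↔ α ∈ Ico (0 : ℝ) 1 ∧ alphaEq ε α = y := by
  have : 1 - α - α * phi ε α / (1 - α) = alphaEq ε α := by
    rw [alphaEq, chordSlope]; ring
  rw [IsAlpha0, this]

/-- A quantitative decrease that serves twice: it is strict when `ε < 1/2`, where chord slopes are
below 1, and still gives weak monotonicity at `ε = 1/2`. -/
lemma alphaEq_le (hε : ε ∈ Icc (0 : ℝ) (1 / 2)) {β : ℝ} (hβ : 0 ≤ β) (h : β ≤ α) (hα : α < 1) :
    alphaEq ε α + (α - β) * (1 - chordSlope ε β) ≤ alphaEq ε β := by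
  have h1 := chordSlope_antitoneOn hε ⟨hβ, h.trans_lt hα⟩ ⟨hβ.trans h, hα⟩ h
  unfold alphaEq
  nlinarith [mul_le_mul_of_nonneg_left h1 (hβ.trans h)]

lemma alphaEq_strictAntiOn (hε : ε ∈ Ico (0 : ℝ) (1 / 2)) :
    StrictAntiOn (alphaEq ε) (Ico 0 1) := by
  intro β hβ α hα hβα
  have h1 := alphaEq_le ⟨hε.1, hε.2.le⟩ hβ.1 hβα.le hα.2
  have h2 := chordSlope_lt_one hε hβ
  have : 0 < (α - β) * (1 - chordSlope ε β) := mul_pos (by linarith) (by linarith)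
  linarith

/-- The equation for `α₀` has exactly one solution. -/
lemma existsUnique_isAlpha0 (hε : ε ∈ Icc (0 : ℝ) (1 / 2)) {y : ℝ} (hy : 1 / q0 ε < y)
    (hy1 : y ≤ 1) : ∃! α, IsAlpha0 ε y α := by
  -- At `ε = 1/2` one has `q₀ = 1`, which leaves no `y` with `1/q₀ < y ≤ 1`.
  have hε' : ε < 1 / 2 := by
    refine lt_of_le_of_ne hε.2 ?_
    rintro rfl
    norm_num [q0] at hy
    linarith
  obtain ⟨α, hα, hlt⟩ := exists_chordSlope_lt hε (c := min y 1) (lt_min hy (hy.trans_le hy1))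
  -- Near `1` the left side of the equation is below `y`.
  obtain ⟨c, hcy, hc1, hcs⟩ : ∃ c, c < y ∧ c < 1 ∧ chordSlope ε α < c := by
    obtain ⟨c, h1, h2⟩ := exists_between hlt
    exact ⟨c, h2.trans_le (min_le_left _ _), h2.trans_le (min_le_right _ _), h1⟩
  set γ := max α (1 - (y - c)) with hγ
  have hγI : γ ∈ Ico (0 : ℝ) 1 :=
    ⟨hα.1.le.trans (le_max_left _ _), max_lt hα.2 (by linarith)⟩
  have hγs : chordSlope ε γ < c :=
    (chordSlope_antitoneOn hε ⟨hα.1.le, hα.2⟩ hγI (le_max_left _ _)).trans_lt hcs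
  have hγy : alphaEq ε γ ≤ y := by
    have h1 : 1 - γ ≤ y - c := by linarith [le_max_right α (1 - (y - c))]
    have h2 : γ * chordSlope ε γ ≤ 1 * c := by
      have := chordSlope_pos hε hγI
      exact mul_le_mul hγI.2.le hγs.le this.le zero_le_one
    unfold alphaEq
    linarith
  have hcont : ContinuousOn (alphaEq ε) (Icc 0 γ) := by
    have := (continuousOn_chordSlope hε).mono (show Icc 0 γ ⊆ Ico 0 1 from
      fun x hx => ⟨hx.1, hx.2.trans_lt hγI.2⟩)
    unfold alphaEq
    exact (by fun_prop : ContinuousOn (fun α : ℝ => 1 - α) _).add (continuousOn_id.mul this)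
  have h0 : alphaEq ε 0 = 1 := by simp [alphaEq]
  have := intermediate_value_Icc' hγI.1 hcont (show y ∈ Icc (alphaEq ε γ) (alphaEq ε 0) from
    ⟨hγy, by rw [h0]; exact hy1⟩)
  obtain ⟨β, hβ, hβy⟩ := this
  have hβI : β ∈ Ico (0 : ℝ) 1 := ⟨hβ.1, hβ.2.trans_lt hγI.2⟩
  refine ⟨β, isAlpha0_iff.2 ⟨hβI, hβy⟩, fun β' hβ' => ?_⟩
  obtain ⟨h1, h2⟩ := isAlpha0_iff.1 hβ'
  exact (alphaEq_strictAntiOn ⟨hε.1, hε'⟩).injOn h1 hβI (h2.trans hβy.symm)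

end Exponent

/-! ### The function `κ`: its three regimes and its monotonicity. -/

section Kappa

variable {q ε x : ℝ}

lemma yLin_le_one (hq : 1 < q) (hx : x ≤ 1) : yLin q x ≤ 1 := by
  have : 0 < q := by linarith
  unfold yLin
  rw [div_mul_eq_mul_div, ← add_div, div_le_one this]
  nlinarith

lemma yLin_strictMono (hq : 1 < q) : StrictMono (yLin q) := by
  intro x y hxy
  have : 0 < (q - 1) / q := div_pos (by linarith) (by linarith)
  unfold yLin
  nlinarith

lemma isAlpha0_alpha0 (hε : ε ∈ Icc (0 : ℝ) (1 / 2)) {y : ℝ} (hy : 1 / q0 ε < y)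
    (hy1 : y ≤ 1) : IsAlpha0 ε y (alpha0 ε y) := by
  have h := (existsUnique_isAlpha0 hε hy hy1).exists
  rw [alpha0, dif_pos h]
  exact h.choose_spec

lemma neg_div_phi_one_sub : -(x / phi ε (1 - x)) = 1 / chordSlope ε (1 - x) := by
  rw [chordSlope, sub_sub_cancel, one_div_div, div_neg]

/-- The cases in the definition of `κ`, in terms of the chord slope. -/
lemma kappa_cases (hε : ε ∈ Icc (0 : ℝ) (1 / 2)) (hq : 1 < q) (hx : x ∈ Icc (0 : ℝ) 1) :
    (kappa q x ε = q0 ε ∧ (x = 0 ∨ yLin q x ≤ 1 / q0 ε)) ∨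
    (0 < x ∧ 1 / q0 ε < yLin q x ∧ kappa q x ε = 1 / chordSlope ε (1 - x) ∧
      q ≤ kappa q x ε) ∨
    (0 < x ∧ ∃ α ∈ Ico (0 : ℝ) 1, alphaEq ε α = yLin q x ∧ 1 / q0 ε < yLin q x ∧
      kappa q x ε = 1 / chordSlope ε α ∧ 1 / chordSlope ε (1 - x) < q ∧ kappa q x ε ≤ q) := by
  rcases hx.1.eq_or_lt with rfl | hx0
  · left; simp [kappa]
  by_cases hy : yLin q x ≤ 1 / q0 ε
  · exact Or.inl ⟨by rw [kappa, if_neg hx0.ne', if_pos hy], Or.inr hy⟩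
  right
  have hy' := lt_of_not_ge hy
  by_cases h2 : q ≤ -(x / phi ε (1 - x))
  · left
    have : kappa q x ε = -(x / phi ε (1 - x)) := by
      rw [kappa, if_neg hx0.ne', if_neg hy, if_pos h2]
    rw [this, neg_div_phi_one_sub]
    rw [neg_div_phi_one_sub] at h2
    exact ⟨hx0, hy', rfl, h2⟩
  · right
    have hk : kappa q x ε = (alpha0 ε (yLin q x) - 1) / phi ε (alpha0 ε (yLin q x)) := by
      rw [kappa, if_neg hx0.ne', if_neg hy, if_neg h2]
    obtain ⟨hα, he⟩ := isAlpha0_iff.1 (isAlpha0_alpha0 hε hy' (yLin_le_one hq hx.2))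
    generalize alpha0 ε (yLin q x) = α at *
    rw [neg_div_phi_one_sub, not_le] at h2
    have hk' : kappa q x ε = 1 / chordSlope ε α := by
      rw [hk, chordSlope, one_div_div, ← neg_sub, neg_div, div_neg]
    refine ⟨hx0, α, hα, he, hy', hk', h2, ?_⟩
    rw [hk']
    by_contra hcon
    rw [not_le] at hcon
    have hq0 : 0 < q := by linarith
    have hxI : 1 - x ∈ Ico (0 : ℝ) 1 := ⟨by linarith [hx.2], by linarith⟩
    have hs := chordSlope_pos hε hα
    have hsx := chordSlope_pos hε hxI
    -- If `κ > q`, the chord slope at `α` is below `1/q`, hence below the one at `1-x`, so `α >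
    -- 1-x`. But the equation for `α` with slope below `1/q` forces `α ≤ 1-x`.
    have hlt : 1 - x < α := by
      by_contra h
      have := one_div_le_one_div_of_le hsx (chordSlope_antitoneOn hε hα hxI (not_lt.1 h))
      linarith
    have hs1 : chordSlope ε α < 1 / q := by
      rw [lt_div_iff₀ hq0]; rwa [lt_div_iff₀ hs, mul_comm] at hcon
    have h3 : α * chordSlope ε α ≤ α * (1 / q) := mul_le_mul_of_nonneg_left hs1.le hα.1
    have h4 : yLin q x = x + (1 - x) * (1 / q) := by
      unfold yLin; field_simp; ring
    have h5 : 0 < 1 - 1 / q := by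
      rw [sub_pos, div_lt_one hq0]; exact hq
    rw [h4, alphaEq] at he
    nlinarith [mul_pos (sub_pos.2 hlt) h5]

lemma one_div_chordSlope_le (hε : ε ∈ Icc (0 : ℝ) (1 / 2)) {α : ℝ} (hα : α ∈ Ico (0 : ℝ) 1) :
    1 / chordSlope ε α ≤ q0 ε := by
  have h := inv_q0_le_chordSlope hε hα
  have hq := zero_lt_one.trans_le (one_le_q0 ε)
  rw [div_le_iff₀ (chordSlope_pos hε hα)]
  rwa [div_le_iff₀ hq, mul_comm] at h

lemma kappa_le_q0 (hε : ε ∈ Icc (0 : ℝ) (1 / 2)) (hq : 1 < q) (hx : x ∈ Icc (0 : ℝ) 1) :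
    kappa q x ε ≤ q0 ε := by
  rcases kappa_cases hε hq hx with ⟨h, -⟩ | ⟨h0, -, h, -⟩ | ⟨-, α, hα, -, -, h, -⟩
  · exact h.le
  · exact h.trans_le (one_div_chordSlope_le hε ⟨by linarith [hx.2], by linarith⟩)
  · exact h.trans_le (one_div_chordSlope_le hε hα)

/-- Within each regime `κ` is an inverse chord slope at a point moving left as `x` grows. The value
`q` separates the last two regimes, and `1 / chordSlope ε (1 - x)`, once below `q`, cannot return
above it. -/
lemma kappa_antitoneOn (hε : ε ∈ Icc (0 : ℝ) (1 / 2)) (hq : 1 < q) :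
    AntitoneOn (fun x => kappa q x ε) (Icc 0 1) := by
  intro x hx x' hx' hxx'
  simp only
  rcases hxx'.eq_or_lt with rfl | hlt
  · exact le_rfl
  have hq0 : 0 < q := by linarith
  have hylt := yLin_strictMono hq hlt
  rcases kappa_cases hε hq hx with ⟨h, -⟩ | ⟨h0, hy, h, hqk⟩ | ⟨h0, α, hα, he, hy, h, hxq, hkq⟩
  · rw [h]; exact kappa_le_q0 hε hq hx'
  · rcases kappa_cases hε hq hx' with ⟨-, h' | h'⟩ | ⟨h0', -, h', -⟩ | ⟨h0', α', hα', -, -, h', -, hkq'⟩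
    · linarith
    · linarith
    · rw [h, h']
      have hI : 1 - x' ∈ Ico (0 : ℝ) 1 := ⟨by linarith [hx'.2], by linarith⟩
      have hI' : 1 - x ∈ Ico (0 : ℝ) 1 := ⟨by linarith [hx.2], by linarith⟩
      exact one_div_le_one_div_of_le (chordSlope_pos hε hI')
        (chordSlope_antitoneOn hε hI hI' (by linarith))
    · exact hkq'.trans hqk
  · rcases kappa_cases hε hq hx' with ⟨-, h' | h'⟩ | ⟨h0', -, h', hqk'⟩ | ⟨h0', α', hα', he', -, h', -⟩
    · linarith
    · linarith
    · have hI : 1 - x' ∈ Ico (0 : ℝ) 1 := ⟨by linarith [hx'.2], by linarith⟩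
      have hI' : 1 - x ∈ Ico (0 : ℝ) 1 := ⟨by linarith [hx.2], by linarith⟩
      have := one_div_le_one_div_of_le (chordSlope_pos hε hI')
        (chordSlope_antitoneOn hε hI hI' (by linarith))
      linarith
    · rw [h, h']
      refine one_div_le_one_div_of_le (chordSlope_pos hε hα) (chordSlope_antitoneOn hε hα' hα ?_)
      by_contra hcon
      rw [not_le] at hcon
      have := alphaEq_le hε hα.1 hcon.le hα'.2
      have h3 : 0 ≤ (α' - α) * (1 - chordSlope ε α) :=
        mul_nonneg (by linarith) (by linarith [chordSlope_le_one hε hα])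
      linarith

end Kappa


/-! ### Norms on the cube, tensorization and interpolation. -/

section Norms

variable {n : ℕ}

lemma mean_nonneg {f : Cube n → ℝ} (hf : ∀ v, 0 ≤ f v) : 0 ≤ mean f :=
  div_nonneg (Finset.sum_nonneg fun v _ => hf v) (by positivity)

lemma mean_mono {f g : Cube n → ℝ} (h : ∀ v, f v ≤ g v) : mean f ≤ mean g := by
  unfold mean
  gcongr with v
  exact h v

lemma mean_add (f g : Cube n → ℝ) : mean (fun v => f v + g v) = mean f + mean g := by
  unfold mean; rw [Finset.sum_add_distrib, add_div]

lemma mean_const_mul (c : ℝ) (f : Cube n → ℝ) : mean (fun v => c * f v) = c * mean f := by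
  unfold mean; rw [← Finset.mul_sum, mul_div_assoc]

lemma mean_const (c : ℝ) : mean (fun _ : Cube n => c) = c := by
  simp [mean]

lemma mean_pos {f : Cube n → ℝ} (hf : ∀ v, 0 ≤ f v) {v : Cube n} (hv : 0 < f v) : 0 < mean f :=
  div_pos (Finset.sum_pos' (fun v _ => hf v) ⟨v, Finset.mem_univ v, hv⟩) (by positivity)

lemma sum_cube_succ (F : Cube (n + 1) → ℝ) :
    ∑ v, F v = ∑ w : Cube n, F (Fin.cons true w) + ∑ w : Cube n, F (Fin.cons false w) := by
  rw [← (Fin.consEquiv (fun _ : Fin (n + 1) => Bool)).sum_comp, Fintype.sum_prod_type,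
    Fintype.sum_bool]
  rfl

lemma mean_succ (F : Cube (n + 1) → ℝ) :
    mean F = (mean (fun w : Cube n => F (Fin.cons true w)) +
      mean (fun w : Cube n => F (Fin.cons false w))) / 2 := by
  unfold mean
  rw [sum_cube_succ]
  field_simp
  ring

lemma noise_kernel (ε : ℝ) (x y : Cube n) :
    ε ^ hammingDist y x * (1 - ε) ^ (n - hammingDist y x) =
      ∏ i, if y i = x i then 1 - ε else ε := by
  rw [Finset.prod_ite, Finset.prod_const, Finset.prod_const, mul_comm]
  congr 2
  have h := Finset.card_filter_add_card_filter_not (s := (Finset.univ : Finset (Fin n)))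
    (fun i => y i = x i)
  rw [Finset.card_univ, Fintype.card_fin] at h
  simp only [hammingDist, ne_eq]
  omega

lemma noise_apply (ε : ℝ) (f : Cube n → ℝ) (x : Cube n) :
    noise ε f x = ∑ y, (∏ i, if y i = x i then 1 - ε else ε) * f y := by
  simp only [noise, noise_kernel]

lemma noise_succ (ε : ℝ) (f : Cube (n + 1) → ℝ) (b : Bool) (x : Cube n) :
    noise ε f (Fin.cons b x) =
      (1 - ε) * noise ε (fun w => f (Fin.cons b w)) x +
        ε * noise ε (fun w => f (Fin.cons (!b) w)) x := by
  simp only [noise_apply]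
  rw [sum_cube_succ, Finset.mul_sum, Finset.mul_sum]
  simp only [Fin.prod_univ_succ, Fin.cons_zero, Fin.cons_succ]
  cases b <;> simp [mul_assoc, add_comm]

lemma lpNorm_nonneg (p : ℝ) (f : Cube n → ℝ) : 0 ≤ lpNorm p f :=
  rpow_nonneg (mean_nonneg fun _ => rpow_nonneg (abs_nonneg _) _) _

lemma lpNorm_rpow {p : ℝ} (hp : 0 < p) (f : Cube n → ℝ) :
    lpNorm p f ^ p = mean (fun x => |f x| ^ p) := by
  rw [lpNorm, ← rpow_mul (mean_nonneg fun _ => rpow_nonneg (abs_nonneg _) _),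
    one_div_mul_cancel hp.ne', rpow_one]

lemma lpNorm_two_sq (f : Cube n → ℝ) : lpNorm 2 f ^ 2 = mean (fun x => f x ^ 2) := by
  rw [← rpow_two, lpNorm_rpow two_pos]
  simp

lemma lpNorm_one (f : Cube n → ℝ) : lpNorm 1 f = mean (fun x => |f x|) := by
  simp [lpNorm]

lemma lpNorm_pos {p : ℝ} {f : Cube n → ℝ} (hf : f ≠ 0) : 0 < lpNorm p f := by
  obtain ⟨v, hv⟩ := Function.ne_iff.1 hf
  exact rpow_pos_of_pos (mean_pos (fun _ => rpow_nonneg (abs_nonneg _) _)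
    (rpow_pos_of_pos (abs_pos.2 hv) p)) _

lemma mean_mul_sq_le (f g : Cube n → ℝ) :
    mean (fun x => f x * g x) ^ 2 ≤ mean (fun x => f x ^ 2) * mean (fun x => g x ^ 2) := by
  unfold mean
  rw [div_pow, div_mul_div_comm, ← sq]
  gcongr
  exact Finset.sum_mul_sq_le_sq_mul_sq _ _ _

lemma mean_mul_le (f g : Cube n → ℝ) :
    mean (fun x => f x * g x) ≤ lpNorm 2 f * lpNorm 2 g := by
  refine le_of_abs_le (abs_le_of_sq_le_sq ?_ (mul_nonneg (lpNorm_nonneg _ _) (lpNorm_nonneg _ _)))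
  rw [mul_pow, lpNorm_two_sq, lpNorm_two_sq]
  exact mean_mul_sq_le f g

/-- A two-point inequality tensorizes. -/
theorem TwoPoint.lpNorm_noise_le {ε p C : ℝ} (hε : ε ∈ Icc (0 : ℝ) (1 / 2)) (hp : 0 < p)
    (hC : 0 ≤ C) (h : TwoPoint (2 * ε * (1 - ε)) p C) :
    ∀ (n : ℕ) (f : Cube n → ℝ), lpNorm 2 (noise ε f) ≤ C ^ n * lpNorm p f := by
  intro n
  induction n with
  | zero =>
    intro f
    have hn : noise ε f = f := by
      funext x
      rw [noise_apply]
      simp [Subsingleton.elim _ x]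
    rw [hn, pow_zero, one_mul]
    have : ∀ p : ℝ, 0 < p → lpNorm p f = |f default| := by
      intro p hp
      rw [lpNorm, mean]
      simp only [Finset.univ_unique, Finset.sum_singleton, pow_zero, div_one]
      rw [← rpow_mul (abs_nonneg _), mul_one_div_cancel hp.ne', rpow_one]
      exact congrArg _ (congrArg f (Subsingleton.elim _ _))
    rw [this 2 two_pos, this p hp]
  | succ n ih =>
    intro f
    set f₁ : Cube n → ℝ := fun w => f (Fin.cons true w) with hf₁
    set f₀ : Cube n → ℝ := fun w => f (Fin.cons false w) with hf₀
    have hδ : 0 ≤ 2 * ε * (1 - ε) := by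
      have := hε.1; have : 0 ≤ 1 - ε := by linarith [hε.2]
      positivity
    have hδ1 : 0 ≤ 1 - 2 * ε * (1 - ε) := by nlinarith [sq_nonneg ε, sq_nonneg (1 - ε)]
    set u := lpNorm p f₁
    set v := lpNorm p f₀
    have hu : 0 ≤ u := lpNorm_nonneg _ _
    have hv : 0 ≤ v := lpNorm_nonneg _ _
    have h1 : lpNorm 2 (noise ε f₁) ≤ C ^ n * u := ih f₁
    have h0 : lpNorm 2 (noise ε f₀) ≤ C ^ n * v := ih f₀
    -- Splitting off one coordinate, the square terms get `(1-ε)² + ε² = 1-δ` and the cross term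
    -- `2δ`. Cauchy-Schwarz and induction then reduce to the two-point inequality for the pair of
    -- `L^p` norms of the halves.
    have hsq : lpNorm 2 (noise ε f) ^ 2 =
        ((1 - 2 * ε * (1 - ε)) * (lpNorm 2 (noise ε f₁) ^ 2 + lpNorm 2 (noise ε f₀) ^ 2) +
          2 * (2 * ε * (1 - ε)) * mean (fun x => noise ε f₁ x * noise ε f₀ x)) / 2 := by
      simp only [lpNorm_two_sq]
      rw [mean_succ]
      simp only [noise_succ, Bool.not_true, Bool.not_false]
      rw [← mean_add, ← mean_add, ← mean_const_mul, ← mean_const_mul, ← mean_add]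
      congr 2
      funext x
      simp only [hf₁, hf₀]
      ring
    have hcs := mean_mul_le (noise ε f₁) (noise ε f₀)
    have hcs' : mean (fun x => noise ε f₁ x * noise ε f₀ x) ≤ (C ^ n * u) * (C ^ n * v) :=
      hcs.trans (mul_le_mul h1 h0 (lpNorm_nonneg _ _) (by positivity))
    have hs1 := pow_le_pow_left₀ (lpNorm_nonneg _ _) h1 2
    have hs0 := pow_le_pow_left₀ (lpNorm_nonneg _ _) h0 2
    have htp := h u v hu hv
    have hN : (u ^ p + v ^ p) / 2 = lpNorm p f ^ p := by
      rw [lpNorm_rpow hp, lpNorm_rpow hp, lpNorm_rpow hp, mean_succ]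
    have hN2 : (lpNorm p f ^ p) ^ (2 / p) = lpNorm p f ^ 2 := by
      rw [← rpow_mul (lpNorm_nonneg _ _), mul_div_cancel₀ _ hp.ne', rpow_two]
    rw [hN, hN2] at htp
    refine le_of_abs_le (abs_le_of_sq_le_sq ?_ (mul_nonneg (by positivity) (lpNorm_nonneg _ _)))
    rw [hsq]
    have hCn : 0 ≤ (C ^ n) ^ 2 := by positivity
    calc _ ≤ ((1 - 2 * ε * (1 - ε)) * ((C ^ n * u) ^ 2 + (C ^ n * v) ^ 2) +
          2 * (2 * ε * (1 - ε)) * ((C ^ n * u) * (C ^ n * v))) / 2 := by gcongr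
      _ = (C ^ n) ^ 2 * ((1 - 2 * ε * (1 - ε)) * (u ^ 2 + v ^ 2) +
          2 * (2 * ε * (1 - ε)) * (u * v)) / 2 := by ring
      _ ≤ (C ^ n) ^ 2 * (2 * C ^ 2 * lpNorm p f ^ 2) / 2 := by gcongr
      _ = _ := by ring

lemma lpNorm_const_mul {p : ℝ} (hp : 0 < p) {c : ℝ} (hc : 0 ≤ c) (f : Cube n → ℝ) :
    lpNorm p (fun v => c * f v) = c * lpNorm p f := by
  have : ∀ v, |c * f v| ^ p = c ^ p * |f v| ^ p := fun v => by
    rw [abs_mul, abs_of_nonneg hc, mul_rpow hc (abs_nonneg _)]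
  rw [lpNorm]
  simp only [this]
  rw [mean_const_mul, mul_rpow (rpow_nonneg hc _)
    (mean_nonneg fun _ => rpow_nonneg (abs_nonneg _) _), ← rpow_mul hc, mul_one_div_cancel hp.ne',
    rpow_one, lpNorm]

lemma noise_const_mul (ε c : ℝ) (f : Cube n → ℝ) :
    noise ε (fun v => c * f v) = fun v => c * noise ε f v := by
  funext x
  rw [noise, noise, Finset.mul_sum]
  exact Finset.sum_congr rfl fun y _ => by ring

lemma noise_add (ε : ℝ) (f g : Cube n → ℝ) :
    noise ε (fun v => f v + g v) = fun v => noise ε f v + noise ε g v := by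
  funext x
  rw [noise, noise, noise, ← Finset.sum_add_distrib]
  exact Finset.sum_congr rfl fun y _ => by ring

/-- Monotonicity of the norms with respect to the uniform probability measure. -/
lemma lpNorm_mono_exp {p r : ℝ} (hp : 0 < p) (hpr : p ≤ r) (f : Cube n → ℝ) :
    lpNorm p f ≤ lpNorm r f := by
  have hr := hp.trans_le hpr
  have h := Real.rpow_arith_mean_le_arith_mean_rpow Finset.univ (fun _ : Cube n => 1 / (2 : ℝ) ^ n)
    (fun v => |f v| ^ p) (fun _ _ => by positivity) (by simp) (fun _ _ => by positivity)
    ((one_le_div hp).2 hpr)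
  rw [← Finset.mul_sum, ← Finset.mul_sum, one_div_mul_eq_div, one_div_mul_eq_div] at h
  have h2 : ∀ v, (|f v| ^ p) ^ (r / p) = |f v| ^ r := fun v => by
    rw [← rpow_mul (abs_nonneg _), mul_div_cancel₀ _ hp.ne']
  simp only [h2] at h
  change mean (fun v => |f v| ^ p) ^ (r / p) ≤ mean (fun v => |f v| ^ r) at h
  rw [← lpNorm_rpow hp, ← lpNorm_rpow hr, ← rpow_mul (lpNorm_nonneg _ _),
    mul_div_cancel₀ _ hp.ne'] at h
  exact (rpow_le_rpow_iff (lpNorm_nonneg _ _) (lpNorm_nonneg _ _) hr).1 h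

/-- Monotonicity of the norms with respect to the counting measure. -/
lemma lpNorm_le_of_le_exp {p r : ℝ} (hp : 0 < p) (hpr : p ≤ r) (f : Cube n → ℝ) :
    lpNorm r f ≤ 2 ^ (n * (1 / p - 1 / r)) * lpNorm p f := by
  have hr := hp.trans_le hpr
  have hsum : (∑ v, |f v| ^ r) ≤ (∑ v, |f v| ^ p) ^ (r / p) := by
    have h2 : ∀ v, |f v| ^ r = (|f v| ^ p) ^ (r / p) := fun v => by
      rw [← rpow_mul (abs_nonneg _), mul_div_cancel₀ _ hp.ne']
    simp only [h2]
    set S := ∑ v, |f v| ^ p with hS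
    have hS0 : 0 ≤ S := Finset.sum_nonneg fun _ _ => by positivity
    have h3 : ∀ v, (|f v| ^ p) ^ (r / p) ≤ |f v| ^ p * S ^ (r / p - 1) := fun v => by
      have h4 : |f v| ^ p ≤ S :=
        Finset.single_le_sum (f := fun v => |f v| ^ p) (fun _ _ => by positivity)
          (Finset.mem_univ v)
      have h5 : 0 ≤ |f v| ^ p := by positivity
      have h6 : 1 ≤ r / p := (one_le_div hp).2 hpr
      calc (|f v| ^ p) ^ (r / p) = (|f v| ^ p) ^ (1 + (r / p - 1)) := by ring_nf
        _ = (|f v| ^ p) * (|f v| ^ p) ^ (r / p - 1) := by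
          rw [rpow_add_of_nonneg h5 zero_le_one (by linarith), rpow_one]
        _ ≤ _ := by gcongr
    refine (Finset.sum_le_sum fun v _ => h3 v).trans_eq ?_
    rw [← Finset.sum_mul, ← hS, ← rpow_one_add' hS0]
    · ring_nf
    · have : 0 < r / p := by positivity
      intro h; linarith
  have hpw : (0 : ℝ) < 2 ^ n := by positivity
  have hS0 : 0 ≤ ∑ v, |f v| ^ p := Finset.sum_nonneg fun _ _ => by positivity
  rw [← rpow_le_rpow_iff (lpNorm_nonneg _ _) (mul_nonneg (by positivity) (lpNorm_nonneg _ _)) hr,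
    lpNorm_rpow hr, mul_rpow (by positivity) (lpNorm_nonneg _ _), lpNorm, ← rpow_mul
    (mean_nonneg fun _ => by positivity), mean, mean, ← rpow_mul zero_le_two,
    div_rpow hS0 hpw.le, one_div_mul_eq_div]
  have e : ((2 : ℝ) ^ n) ^ (r / p) = 2 ^ (n * (1 / p - 1 / r) * r) * 2 ^ n := by
    rw [← rpow_natCast, ← rpow_mul zero_le_two, ← rpow_add two_pos]
    congr 1
    field_simp
    ring
  rw [e, mul_div_assoc', mul_div_mul_left _ _ (by positivity)]
  gcongr

/-- Log-convexity of the norms in the inverse exponent, with `‖f‖₁ = 1`. -/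
lemma lpNorm_interpolate {p r : ℝ} (hp : 1 ≤ p) (hpr : p ≤ r) (hr : 1 < r) {f : Cube n → ℝ}
    (hf : lpNorm 1 f = 1) :
    lpNorm p f ≤ lpNorm r f ^ ((1 - 1 / p) / (1 - 1 / r)) := by
  have hp0 : 0 < p := by linarith
  have hr0 : 0 < r := by linarith
  have hr1 : 0 < r - 1 := by linarith
  rcases hp.eq_or_lt with rfl | hp1
  · rw [hf]; simp
  rcases hpr.eq_or_lt with rfl | hpr'
  · rw [div_self, rpow_one]
    have : 1 / p < 1 := by rw [div_lt_one hp0]; exact hp1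
    linarith
  -- `p = (1 - s) + s r`
  set s := (p - 1) / (r - 1) with hs
  have hs0 : 0 < s := div_pos (by linarith) hr1
  have hs1 : s < 1 := by rw [hs, div_lt_one hr1]; linarith
  have hps : p = (1 - s) + r * s := by rw [hs]; field_simp; ring
  have hh := Real.inner_le_Lp_mul_Lq_of_nonneg Finset.univ (p := 1 / (1 - s)) (q := 1 / s)
    (f := fun v : Cube n => |f v| ^ (1 - s)) (g := fun v => |f v| ^ (r * s))
    ⟨by simp, one_div_pos.2 (by linarith), one_div_pos.2 hs0⟩
    (fun _ _ => by positivity) (fun _ _ => by positivity)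
  have e1 : ∀ v, |f v| ^ (1 - s) * |f v| ^ (r * s) = |f v| ^ p := fun v => by
    rw [← rpow_add_of_nonneg (abs_nonneg _) (by linarith) (by positivity), ← hps]
  have e2 : ∀ v, (|f v| ^ (1 - s)) ^ (1 / (1 - s)) = |f v| := fun v => by
    rw [← rpow_mul (abs_nonneg _), mul_one_div_cancel (by linarith), rpow_one]
  have e3 : ∀ v, (|f v| ^ (r * s)) ^ (1 / s) = |f v| ^ r := fun v => by
    rw [← rpow_mul (abs_nonneg _), mul_assoc, mul_one_div_cancel hs0.ne', mul_one]
  simp only [e1, e2, e3, one_div_one_div] at hh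
  have hpw : (0 : ℝ) < 2 ^ n := by positivity
  have hS1 : ∑ v, |f v| = 2 ^ n := by
    rw [lpNorm_one, mean, div_eq_one_iff_eq hpw.ne'] at hf
    exact hf
  have hSr : 0 ≤ ∑ v, |f v| ^ r := Finset.sum_nonneg fun _ _ => by positivity
  have hm : mean (fun v => |f v| ^ p) ≤ mean (fun v => |f v| ^ r) ^ s := by
    rw [mean, mean, div_rpow hSr hpw.le, div_le_iff₀ hpw]
    refine hh.trans_eq ?_
    rw [hS1, div_mul_eq_mul_div, mul_div_assoc, mul_comm]
    congr 1
    rw [eq_div_iff (by positivity), ← rpow_add hpw]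
    simp
  rw [← lpNorm_rpow hp0, ← lpNorm_rpow hr0, ← rpow_mul (lpNorm_nonneg _ _)] at hm
  rw [← rpow_le_rpow_iff (lpNorm_nonneg _ _) (rpow_nonneg (lpNorm_nonneg _ _) _) hp0,
    ← rpow_mul (lpNorm_nonneg _ _)]
  refine hm.trans_eq ?_
  congr 1
  rw [hs]
  have : 1 - 1 / r ≠ 0 := by
    have : 1 / r < 1 := by rw [div_lt_one hr0]; exact hr
    linarith
  field_simp

end Norms

/-! ### The hypercontractive inequalities. -/

section Hypercontractivity

variable {n : ℕ} {ε q : ℝ} {f : Cube n → ℝ}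

/-- The hypercontractive inequality for the noise operator. -/
lemma lpNorm_noise_le_q0 (hε : ε ∈ Icc (0 : ℝ) (1 / 2)) (f : Cube n → ℝ) :
    lpNorm 2 (noise ε f) ≤ lpNorm (q0 ε) f := by
  -- For each `α < 1` the supporting exponent is at most `q₀` and its constant is at most `2^(1-α)`;
  -- the limit `α → 1` removes the constant.
  have ht : Tendsto (fun α : ℝ => ((2 : ℝ) ^ (1 - α)) ^ n * lpNorm (q0 ε) f) (𝓝[<] 1)
      (𝓝 (((2 : ℝ) ^ ((1 : ℝ) - 1)) ^ n * lpNorm (q0 ε) f)) := by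
    have : Continuous (fun α : ℝ => ((2 : ℝ) ^ (1 - α)) ^ n * lpNorm (q0 ε) f) :=
      ((continuous_const.rpow (by fun_prop) (fun _ => Or.inl two_ne_zero)).pow n).mul
        continuous_const
    exact (this.tendsto 1).mono_left nhdsWithin_le_nhds
  rw [sub_self, rpow_zero, one_pow, one_mul] at ht
  refine ge_of_tendsto ht ?_
  filter_upwards [Ioo_mem_nhdsLT (show (0 : ℝ) < 1 by norm_num)] with α hα
  have hα' : α ∈ Ico (0 : ℝ) 1 := ⟨hα.1.le, hα.2⟩
  obtain ⟨p, hp, hpq, -, h⟩ := exists_supporting_exponent hε hα'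
  have hp0 : 0 < p := by linarith
  refine (h.lpNorm_noise_le hε hp0 (by positivity) n f).trans ?_
  have h1 := phi_nonpos hε hα'
  have h2 : (1 - α) / p ≤ 1 - α := div_le_self (by linarith [hα.2]) hp
  gcongr
  · exact lpNorm_nonneg _ _
  · exact one_le_two
  · linarith
  · exact lpNorm_mono_exp hp0 hpq f

/-- With `N = ‖f‖_(1/s)`, the hypothesis bounds the tensorized constant `2^(n(1-α)(1/p-s))` by
`N^((1/p-s)/(1-s))`, and interpolation bounds `‖f‖_p` by `N^((1-1/p)/(1-s))`. The two exponents add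
up to 1. -/
lemma lpNorm_noise_le_of_le (hε : ε ∈ Ico (0 : ℝ) (1 / 2)) {α : ℝ} (hα : α ∈ Ico (0 : ℝ) 1)
    (hf : lpNorm 1 f = 1)
    (h : 2 ^ (n * ((1 - α) * (1 - chordSlope ε α))) ≤ lpNorm (1 / chordSlope ε α) f) :
    lpNorm 2 (noise ε f) ≤ lpNorm (1 / chordSlope ε α) f := by
  have hε' : ε ∈ Icc (0 : ℝ) (1 / 2) := ⟨hε.1, hε.2.le⟩
  obtain ⟨p, hp, hpq, ht, htp⟩ := exists_supporting_exponent hε' hα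
  have hp0 : 0 < p := by linarith
  have hsp := chordSlope_le hε' hα ht
  have hphi := phi_eq_chordSlope (ε := ε) hα.2
  have hs1 := chordSlope_lt_one hε hα
  have hs0 := chordSlope_pos hε' hα
  generalize chordSlope ε α = s at *
  have hpk : p ≤ 1 / s := by
    rw [le_div_iff₀ hs0]; rwa [le_div_iff₀ hp0, mul_comm] at hsp
  have h1k : 1 < 1 / s := by rw [lt_div_iff₀ hs0]; linarith
  have hint := lpNorm_interpolate hp hpk h1k hf
  rw [one_div_one_div] at hint
  set N := lpNorm (1 / s) f
  have hN0 : 0 < N := lt_of_lt_of_le (by positivity) h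
  have hs1' : 0 < 1 - s := by linarith
  refine (htp.lpNorm_noise_le hε' hp0 (by positivity) n f).trans ?_
  have e1 : ((2 : ℝ) ^ (phi ε α + (1 - α) / p)) ^ n =
      (2 ^ (n * ((1 - α) * (1 - s)))) ^ ((1 / p - s) / (1 - s)) := by
    rw [← rpow_natCast, ← rpow_mul zero_le_two, ← rpow_mul zero_le_two, hphi]
    congr 1
    field_simp
    ring
  have hexp : 0 ≤ (1 / p - s) / (1 - s) := div_nonneg (by linarith) hs1'.le
  calc _ ≤ N ^ ((1 / p - s) / (1 - s)) * N ^ ((1 - 1 / p) / (1 - s)) := by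
        rw [e1]
        gcongr
        exact lpNorm_nonneg _ _
    _ = N := by
        rw [← rpow_add hN0, ← add_div, sub_add_sub_cancel', div_self hs1'.ne', rpow_one]

lemma one_le_kappa (hε : ε ∈ Icc (0 : ℝ) (1 / 2)) (hq : 1 < q) {x : ℝ} (hx : x ∈ Icc (0 : ℝ) 1) :
    1 ≤ kappa q x ε := by
  have key : ∀ α ∈ Ico (0 : ℝ) 1, 1 ≤ 1 / chordSlope ε α := fun α hα => by
    rw [le_div_iff₀ (chordSlope_pos hε hα), one_mul]
    exact chordSlope_le_one hε hα
  rcases kappa_cases hε hq hx with ⟨h, -⟩ | ⟨h0, -, h, -⟩ | ⟨-, α, hα, -, -, h, -⟩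
  · exact h.symm ▸ one_le_q0 ε
  · exact h.symm ▸ key _ ⟨by linarith [hx.2], by linarith⟩
  · exact h.symm ▸ key _ hα

lemma lpNorm_eq_two_rpow (hq : 1 < q) (hn : 1 ≤ n) (hf : f ≠ 0) :
    lpNorm q f = 2 ^ (n * (renyiEnt q f / n * (1 - 1 / q))) := by
  have hN := lpNorm_pos (p := q) hf
  have hn' : (n : ℝ) ≠ 0 := by positivity
  have hq1 : q - 1 ≠ 0 := by linarith
  have hq0 : q ≠ 0 := by linarith
  have e : n * (renyiEnt q f / n * (1 - 1 / q)) = Real.logb 2 (lpNorm q f) := by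
    rw [renyiEnt, Real.logb_rpow_eq_mul_logb_of_pos hN]
    field_simp
  rw [e, Real.rpow_logb two_pos (by norm_num) hN]

lemma renyiEnt_div_mem (hq : 1 < q) (hn : 1 ≤ n) (hf : f ≠ 0) (h1 : lpNorm 1 f = 1) :
    renyiEnt q f / n ∈ Icc (0 : ℝ) 1 := by
  have hq0 : 0 < q := by linarith
  have hn' : (0 : ℝ) < n := by positivity
  have he := lpNorm_eq_two_rpow hq hn hf
  have hl := lpNorm_mono_exp one_pos hq.le f
  have hu := lpNorm_le_of_le_exp one_pos hq.le f
  rw [h1, he] at hl hu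
  have hc : 0 < 1 - 1 / q := by rw [sub_pos, div_lt_one hq0]; exact hq
  generalize renyiEnt q f / n = X at *
  rw [mul_one, one_div_one, rpow_le_rpow_left_iff one_lt_two] at hu
  rw [← rpow_zero (2 : ℝ), rpow_le_rpow_left_iff one_lt_two] at hl
  have hu' := le_of_mul_le_mul_left hu hn'
  constructor
  · by_contra hneg
    have := mul_neg_of_neg_of_pos (not_le.1 hneg) hc
    nlinarith
  · nlinarith

/-- The hypercontractive inequality with the exponent `κ`, for normalized functions. -/
lemma lpNorm_noise_le_kappa_of_normalized (hε : ε ∈ Icc (0 : ℝ) (1 / 2)) (hq : 1 < q)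
    (hn : 1 ≤ n) (hf : f ≠ 0) (h1 : lpNorm 1 f = 1) :
    lpNorm 2 (noise ε f) ≤ lpNorm (kappa q (renyiEnt q f / n) ε) f := by
  have hX := renyiEnt_div_mem hq hn hf h1
  have hk1 := one_le_kappa hε hq hX
  rcases hε.2.eq_or_lt with rfl | hε2
  · have h2 := kappa_le_q0 hε hq hX
    have h3 : q0 (1 / 2) = 1 := by norm_num [q0]
    rw [le_antisymm h2 (h3.symm ▸ hk1)]
    exact lpNorm_noise_le_q0 hε f
  have hε' : ε ∈ Ico (0 : ℝ) (1 / 2) := ⟨hε.1, hε2⟩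
  have he := lpNorm_eq_two_rpow hq hn hf
  have hq0 : 0 < q := by linarith
  have hc : 0 < 1 - 1 / q := by rw [sub_pos, div_lt_one hq0]; exact hq
  rcases kappa_cases hε hq hX with ⟨h, -⟩ | ⟨h0, -, h, hqk⟩ | ⟨-, α, hα, hαe, -, h, -, hkq⟩
  · rw [h]; exact lpNorm_noise_le_q0 hε f
  -- Here `q ≤ κ = 1/s`, and interpolating `L^q` between `L¹` and `L^κ` gives `‖f‖_κ ≥ 2^(nX(1-s))`,
  -- the required bound for `α = 1-X`.
  · rw [h] at hk1 hqk ⊢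
    generalize renyiEnt q f / n = X at *
    have hα : 1 - X ∈ Ico (0 : ℝ) 1 := ⟨by linarith [hX.2], by linarith⟩
    refine lpNorm_noise_le_of_le hε' hα h1 ?_
    have hint := lpNorm_interpolate hq.le hqk (hq.trans_le hqk) h1
    have hs : 0 < 1 - chordSlope ε (1 - X) := by linarith [chordSlope_lt_one hε' hα]
    rw [one_div_one_div, he] at hint
    rw [sub_sub_cancel]
    generalize chordSlope ε (1 - X) = s at *
    have := rpow_le_rpow (by positivity) hint (div_pos hs hc).le
    rw [← rpow_mul (lpNorm_nonneg _ _), ← rpow_mul zero_le_two, div_mul_div_cancel₀ hs.ne',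
      div_self hc.ne', rpow_one] at this
    refine le_trans (le_of_eq ?_) this
    congr 1
    have hc' := hc.ne'
    generalize 1 - 1 / q = c at *
    field_simp
  -- Here `κ ≤ q`, and the counting-measure comparison gives `‖f‖_κ ≥ 2^(n(y-s))`; the equation for
  -- `α` says that `y - s = (1-α)(1-s)`.
  · rw [h] at hk1 hkq ⊢
    refine lpNorm_noise_le_of_le hε' hα h1 ?_
    have hcnt := lpNorm_le_of_le_exp (by linarith) hkq f
    rw [one_div_one_div, he] at hcnt
    rw [alphaEq, yLin] at hαe
    generalize chordSlope ε α = s at *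
    have hpos : (0 : ℝ) < 2 ^ (n * (s - 1 / q)) := by positivity
    rw [← div_le_iff₀' hpos, ← rpow_sub two_pos] at hcnt
    refine le_trans (le_of_eq ?_) hcnt
    congr 1
    have e : (q - 1) / q = 1 - 1 / q := by field_simp
    rw [e] at hαe
    linear_combination n * hαe

theorem lpNorm_noise_le_kappa (hε : ε ∈ Icc (0 : ℝ) (1 / 2)) (hq : 1 < q) (hn : 1 ≤ n)
    (hf : f ≠ 0) :
    renyiEnt q (fun v => f v / lpNorm 1 f) / n ∈ Icc (0 : ℝ) 1 ∧
      lpNorm 2 (noise ε f) ≤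
        lpNorm (kappa q (renyiEnt q (fun v => f v / lpNorm 1 f) / n) ε) f := by
  have hN := lpNorm_pos (p := 1) hf
  set g : Cube n → ℝ := fun v => f v / lpNorm 1 f with hg
  have hg' : g = fun v => (lpNorm 1 f)⁻¹ * f v := by
    funext v; rw [hg]; simp only; rw [div_eq_inv_mul]
  have hg1 : lpNorm 1 g = 1 := by
    rw [hg', lpNorm_const_mul one_pos (by positivity), inv_mul_cancel₀ hN.ne']
  have hg0 : g ≠ 0 := by
    intro h0
    rw [h0, lpNorm_one] at hg1
    simp [mean] at hg1
  have hX := renyiEnt_div_mem hq hn hg0 hg1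
  refine ⟨hX, ?_⟩
  have h := lpNorm_noise_le_kappa_of_normalized hε hq hn hg0 hg1
  have hk := one_le_kappa hε hq hX
  generalize kappa q (renyiEnt q g / n) ε = k at *
  rw [hg', noise_const_mul, lpNorm_const_mul two_pos (by positivity),
    lpNorm_const_mul (by linarith) (by positivity)] at h
  exact le_of_mul_le_mul_left h (by positivity)

end Hypercontractivity

/-! ### Spheres with nearly extremal noise norm. -/

section Spheres

variable {n : ℕ} {ε : ℝ}

/-- The Hamming weight. -/
def wt (v : Cube n) : ℕ := hammingDist v (fun _ => false)

lemma wt_le (v : Cube n) : wt v ≤ n := by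
  have := hammingDist_le_card_fintype (x := v) (y := fun _ => false)
  simpa [wt] using this

lemma sphere_apply (r : ℕ) (v : Cube n) : sphere n r v = if wt v = r then 1 else 0 := rfl

lemma sphere_nonneg (r : ℕ) (v : Cube n) : 0 ≤ sphere n r v := by
  rw [sphere_apply]; split_ifs <;> norm_num

lemma prod_ite_eq_pow_wt (s t : ℝ) (v : Cube n) :
    (∏ i, if v i then s else t) = s ^ wt v * t ^ (n - wt v) := by
  rw [Finset.prod_ite, Finset.prod_const, Finset.prod_const]
  have h := Finset.card_filter_add_card_filter_not (s := (Finset.univ : Finset (Fin n)))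
    (fun i => v i = true)
  rw [Finset.card_univ, Fintype.card_fin] at h
  have hw : wt v = (Finset.univ.filter (fun i => v i = true)).card := by
    simp [wt, hammingDist]
  rw [hw]
  congr 2
  omega

lemma wt_cons (b : Bool) (w : Cube n) :
    (wt (Fin.cons b w : Cube (n + 1)) : ℝ) = (if b then 1 else 0) + wt w := by
  have key : ∀ {m : ℕ} (v : Cube m), (wt v : ℝ) = ∑ i, if v i then (1 : ℝ) else 0 := by
    intro m v
    simp [wt, hammingDist]
  rw [key, key, Fin.sum_univ_succ]
  simp

lemma noise_prod (ε s t : ℝ) :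
    noise ε (fun v : Cube n => ∏ i, if v i then s else t) =
      fun x => ∏ i, if x i then (1 - ε) * s + ε * t else (1 - ε) * t + ε * s := by
  funext x
  rw [noise_apply]
  simp only [← Finset.prod_mul_distrib]
  have h := Finset.prod_univ_sum (fun _ : Fin n => (Finset.univ : Finset Bool))
    (fun i b => (if b = x i then 1 - ε else ε) * if b then s else t)
  rw [Fintype.piFinset_univ] at h
  rw [← h]
  refine Finset.prod_congr rfl fun i _ => ?_
  rw [Fintype.sum_bool]
  cases x i <;> simp [add_comm]

lemma noise_nonneg (hε : ε ∈ Icc (0 : ℝ) 1) {f : Cube n → ℝ} (hf : ∀ v, 0 ≤ f v) (x : Cube n) :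
    0 ≤ noise ε f x := by
  have := hε.1
  have : 0 ≤ 1 - ε := by linarith [hε.2]
  exact Finset.sum_nonneg fun y _ => mul_nonneg (by positivity) (hf y)

lemma noise_mono (hε : ε ∈ Icc (0 : ℝ) 1) {f g : Cube n → ℝ} (hfg : ∀ v, f v ≤ g v)
    (x : Cube n) : noise ε f x ≤ noise ε g x := by
  have := hε.1
  have : 0 ≤ 1 - ε := by linarith [hε.2]
  exact Finset.sum_le_sum fun y _ => mul_le_mul_of_nonneg_left (hfg y) (by positivity)

lemma mean_noise_mul (f g : Cube n → ℝ) :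
    mean (fun x => noise ε f x * g x) = mean (fun x => f x * noise ε g x) := by
  unfold mean noise
  congr 1
  simp only [Finset.sum_mul, Finset.mul_sum]
  rw [Finset.sum_comm]
  refine Finset.sum_congr rfl fun y _ => Finset.sum_congr rfl fun x _ => ?_
  rw [hammingDist_comm]
  ring

/-- The noise operator is self-adjoint and positive, so one of the two copies of `f` may be enlarged
to `g`. With `g = z^|v|` the right side is explicit. -/
lemma lpNorm_noise_sq_le (hε : ε ∈ Icc (0 : ℝ) 1) {f g : Cube n → ℝ} (hf : ∀ v, 0 ≤ f v)
    (hfg : ∀ v, f v ≤ g v) :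
    lpNorm 2 (noise ε f) ^ 2 ≤ mean (fun x => f x * noise ε (noise ε g) x) := by
  rw [lpNorm_two_sq, ← mean_noise_mul]
  refine mean_mono fun v => ?_
  rw [sq]
  exact mul_le_mul_of_nonneg_left (noise_mono hε hfg v) (noise_nonneg hε hf v)

lemma lpNorm_two_add_le (f g : Cube n → ℝ) :
    lpNorm 2 (fun v => f v + g v) ≤ lpNorm 2 f + lpNorm 2 g := by
  have h := mean_mul_le f g
  have hf := lpNorm_nonneg 2 f
  have hg := lpNorm_nonneg 2 g
  refine le_of_abs_le (abs_le_of_sq_le_sq ?_ (by positivity))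
  have e : mean (fun v => (f v + g v) ^ 2) =
      mean (fun v => f v ^ 2) + (2 * mean (fun v => f v * g v) + mean (fun v => g v ^ 2)) := by
    rw [← mean_const_mul, ← mean_add, ← mean_add]
    congr 1
    funext v
    ring
  rw [lpNorm_two_sq, e, ← lpNorm_two_sq, ← lpNorm_two_sq]
  nlinarith

lemma lpNorm_two_noise_sum_le {ι : Type*} (s : Finset ι) {c : ι → ℝ} (hc : ∀ k, 0 ≤ c k)
    (F : ι → Cube n → ℝ) :
    lpNorm 2 (noise ε (fun v => ∑ k ∈ s, c k * F k v)) ≤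
      ∑ k ∈ s, c k * lpNorm 2 (noise ε (F k)) := by
  classical
  induction s using Finset.induction_on with
  | empty => simp [noise, lpNorm, mean]
  | insert a s ha ih =>
    simp only [Finset.sum_insert ha]
    rw [noise_add ε (fun v => c a * F a v), noise_const_mul]
    refine (lpNorm_two_add_le _ _).trans ?_
    rw [lpNorm_const_mul two_pos (hc a)]
    gcongr

/-- The product measure on the cube with `P(v_i = 1) = s`. -/
def biasedMass (s : ℝ) (v : Cube n) : ℝ := ∏ i, if v i then s else 1 - s

lemma biasedMass_nonneg {s : ℝ} (h0 : 0 ≤ s) (h1 : s ≤ 1) (v : Cube n) : 0 ≤ biasedMass s v := by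
  refine Finset.prod_nonneg fun i _ => ?_
  split_ifs <;> linarith

lemma biasedMass_cons (s : ℝ) (b : Bool) (w : Cube n) :
    biasedMass s (Fin.cons b w : Cube (n + 1)) = (if b then s else 1 - s) * biasedMass s w := by
  simp [biasedMass, Fin.prod_univ_succ]

lemma sum_biasedMass (n : ℕ) (s : ℝ) : ∑ v : Cube n, biasedMass s v = 1 := by
  induction n with
  | zero => simp [biasedMass]
  | succ n ih =>
    rw [sum_cube_succ]
    simp only [biasedMass_cons, ← Finset.mul_sum, ih]
    simp

lemma sum_biasedMass_sq (n : ℕ) (s : ℝ) :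
    ∑ v : Cube n, biasedMass s v * ((wt v : ℝ) - n * s) ^ 2 = n * (s * (1 - s)) := by
  induction n with
  | zero =>
    simp [biasedMass, wt]
    exact Subsingleton.elim _ _
  | succ n ih =>
    rw [sum_cube_succ, ← Finset.sum_add_distrib]
    have : ∀ w : Cube n, biasedMass s (Fin.cons true w : Cube (n + 1)) *
        ((wt (Fin.cons true w : Cube (n + 1)) : ℝ) - (n + 1 : ℕ) * s) ^ 2 +
        biasedMass s (Fin.cons false w : Cube (n + 1)) *
        ((wt (Fin.cons false w : Cube (n + 1)) : ℝ) - (n + 1 : ℕ) * s) ^ 2 =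
        biasedMass s w * ((wt w : ℝ) - n * s) ^ 2 + (s * (1 - s)) * biasedMass s w := fun w => by
      rw [biasedMass_cons, biasedMass_cons, wt_cons, wt_cons]
      push_cast
      simp
      ring
    simp only [this, Finset.sum_add_distrib, ih, ← Finset.mul_sum, sum_biasedMass]
    push_cast
    ring

/-- Chebyshev's inequality for the Hamming weight. -/
lemma sum_biasedMass_far_le {s η : ℝ} (h0 : 0 ≤ s) (h1 : s ≤ 1) (hη : 0 < η)
    (hn : 1 ≤ n * η ^ 2) :
    ∑ v : Cube n, (if |(wt v : ℝ) - n * s| ≤ η * n then 0 else biasedMass s v) ≤ 1 / 4 := by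
  have hn0 : (0 : ℝ) < n := by
    by_contra h
    have : (n : ℝ) = 0 := le_antisymm (not_lt.1 h) (by positivity)
    rw [this] at hn
    linarith
  have hsq := sum_biasedMass_sq n s
  have hpos : 0 < (η * n) ^ 2 := by positivity
  have key : (η * n) ^ 2 * ∑ v : Cube n,
      (if |(wt v : ℝ) - n * s| ≤ η * n then 0 else biasedMass s v) ≤ n * (s * (1 - s)) := by
    rw [← hsq, Finset.mul_sum]
    refine Finset.sum_le_sum fun v _ => ?_
    have hb := biasedMass_nonneg h0 h1 v
    split_ifs with h
    · rw [mul_zero]; positivity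
    · rw [mul_comm]
      gcongr ?_ * ?_
      rw [← sq_abs ((wt v : ℝ) - n * s)]
      exact pow_le_pow_left₀ (by positivity) (not_le.1 h).le 2
  have hs : s * (1 - s) ≤ 1 / 4 := by nlinarith [sq_nonneg (s - 1 / 2)]
  have h3 : (n : ℝ) * (s * (1 - s)) ≤ (η * n) ^ 2 * (1 / 4) := by
    have : (η * n) ^ 2 = n * (n * η ^ 2) := by ring
    rw [this]
    have h4 : (n : ℝ) * 1 ≤ n * (n * η ^ 2) := by gcongr
    nlinarith
  exact le_of_mul_le_mul_left (key.trans h3) hpos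

/-- Applying the noise twice to `z^|v|` gives a multiple of a product measure. -/
lemma pow_wt_mul_noise_noise (hε : ε ∈ Ioo (0 : ℝ) (1 / 2)) {z : ℝ} (hz : 0 ≤ z) (v : Cube n) :
    z ^ wt v * noise ε (noise ε (fun v => z ^ wt v)) v =
      couplingMass (2 * ε * (1 - ε)) z ^ n *
        biasedMass (couplingBias (2 * ε * (1 - ε)) z) v := by
  have hD := couplingMass_pos (delta_pos hε) (delta_lt_half hε) hz
  have hG : ∀ v : Cube n, z ^ wt v = ∏ i, if v i then z else 1 := fun v => by
    rw [prod_ite_eq_pow_wt, one_pow, mul_one]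
  have hc : couplingMass (2 * ε * (1 - ε)) z ^ n =
      ∏ _i : Fin n, couplingMass (2 * ε * (1 - ε)) z := by simp
  simp only [hG]
  rw [noise_prod, noise_prod, hc, biasedMass, ← Finset.prod_mul_distrib, ← Finset.prod_mul_distrib]
  refine Finset.prod_congr rfl fun i _ => ?_
  rw [one_sub_couplingBias (delta_pos hε) (delta_lt_half hε) hz, couplingBias]
  generalize couplingMass (2 * ε * (1 - ε)) z = D at *
  split_ifs
  · field_simp
    ring
  · field_simp
    ring

/-- The mass of the sphere of radius `k` under the product measure. -/
def sphereMass (n : ℕ) (s : ℝ) (k : ℕ) : ℝ := ∑ v : Cube n, sphere n k v * biasedMass s v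

lemma sphereMass_le_one {s : ℝ} (h0 : 0 ≤ s) (h1 : s ≤ 1) (k : ℕ) : sphereMass n s k ≤ 1 := by
  rw [← sum_biasedMass n s]
  refine Finset.sum_le_sum fun v _ => ?_
  have := biasedMass_nonneg h0 h1 v
  rw [sphere_apply]
  split_ifs <;> linarith

lemma sphereMass_eq (s : ℝ) (k : ℕ) :
    sphereMass n s k = 2 ^ n * mean (sphere n k) * (s ^ k * (1 - s) ^ (n - k)) := by
  rw [mean, mul_div_cancel₀ _ (by positivity), sphereMass, Finset.sum_mul]
  refine Finset.sum_congr rfl fun v _ => ?_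
  rw [sphere_apply, biasedMass, prod_ite_eq_pow_wt]
  split_ifs with h
  · rw [h]
  · simp

/-- `z^|v|` dominates its own restriction to the sphere. Read backwards, a large noise norm forces
the sphere to have large mass under the product measure, which later replaces Stirling's formula. -/
lemma lpNorm_noise_sphere_sq_le (hε : ε ∈ Ioo (0 : ℝ) (1 / 2)) {z : ℝ} (hz : 0 ≤ z) (k : ℕ) :
    (z ^ k * lpNorm 2 (noise ε (sphere n k))) ^ 2 ≤
      (couplingMass (2 * ε * (1 - ε)) z / 2) ^ n *
        sphereMass n (couplingBias (2 * ε * (1 - ε)) z) k := by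
  have hε1 : ε ∈ Icc (0 : ℝ) 1 := ⟨hε.1.le, by linarith [hε.2]⟩
  rw [← lpNorm_const_mul two_pos (by positivity), ← noise_const_mul]
  refine (lpNorm_noise_sq_le hε1 (g := fun v => z ^ wt v)
    (fun v => mul_nonneg (by positivity) (sphere_nonneg k v)) (fun v => ?_)).trans_eq ?_
  · rw [sphere_apply]
    split_ifs with hk
    · rw [hk, mul_one]
    · rw [mul_zero]; positivity
  · rw [mean, sphereMass, div_pow, div_mul_eq_mul_div, Finset.mul_sum]
    congr 1
    refine Finset.sum_congr rfl fun v _ => ?_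
    have := pow_wt_mul_noise_noise hε hz v
    rw [mul_left_comm, ← this, sphere_apply]
    split_ifs with hk
    · rw [hk]; ring
    · ring

/-- By Chebyshev, the part of `z^|v|` at atypical weights carries at most half of the noise norm.
The rest is a sum over at most `n+1` spheres, so by the triangle inequality one of them carries a
`1/(2(n+1))` share. -/
lemma exists_sphere_noise_ge (hε : ε ∈ Ioo (0 : ℝ) (1 / 2)) {z : ℝ} (hz : z ∈ Icc (0 : ℝ) 1)
    {η : ℝ} (hη : 0 < η) (hn : 1 ≤ n * η ^ 2) :
    ∃ k ≤ n, |(k : ℝ) - n * couplingBias (2 * ε * (1 - ε)) z| ≤ η * n ∧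
      √((couplingMass (2 * ε * (1 - ε)) z / 2) ^ n) ≤
        2 * (n + 1) * (z ^ k * lpNorm 2 (noise ε (sphere n k))) := by
  have hε1 : ε ∈ Icc (0 : ℝ) 1 := ⟨hε.1.le, by linarith [hε.2]⟩
  have hz0 := hz.1
  have hTT := fun v : Cube n => pow_wt_mul_noise_noise hε hz0 v
  have hs0 := couplingBias_nonneg (delta_pos hε) (delta_lt_half hε) hz.1
  have hs1 : couplingBias (2 * ε * (1 - ε)) z ≤ 1 :=
    (couplingBias_le_half (delta_pos hε) (delta_lt_half hε) hz).trans (by norm_num)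
  have hD := couplingMass_pos (delta_pos hε) (delta_lt_half hε) hz0
  generalize couplingBias (2 * ε * (1 - ε)) z = s at *
  generalize couplingMass (2 * ε * (1 - ε)) z = D at *
  set g : Cube n → ℝ := fun v => z ^ wt v with hg
  set gC : Cube n → ℝ := fun v => if |(wt v : ℝ) - n * s| ≤ η * n then 0 else g v with hgC
  set S := (Finset.range (n + 1)).filter (fun k : ℕ => |(k : ℝ) - n * s| ≤ η * n) with hS
  set gW : Cube n → ℝ := fun v => ∑ k ∈ S, z ^ k * sphere n k v with hgW
  have hsplit : g = fun v => gC v + gW v := by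
    funext v
    have e : gW v = if |(wt v : ℝ) - n * s| ≤ η * n then z ^ wt v else 0 := by
      simp only [hgW, sphere_apply, mul_ite, mul_one, mul_zero]
      rw [Finset.sum_ite_eq S (wt v) (fun k => z ^ k)]
      have : wt v ∈ S ↔ |(wt v : ℝ) - n * s| ≤ η * n := by
        simp [hS, Nat.lt_succ_of_le (wt_le v)]
      simp only [this]
    rw [e, hgC, hg]
    simp only
    split_ifs <;> simp
  have hg0 : ∀ v, 0 ≤ g v := fun v => by positivity
  have hTg : lpNorm 2 (noise ε g) ^ 2 = (D / 2) ^ n := by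
    rw [lpNorm_two_sq]
    have : (fun x => noise ε g x ^ 2) = fun x => noise ε g x * noise ε g x := by
      funext x; ring
    rw [this, mean_noise_mul]
    have hTT' : ∀ v, g v * noise ε (noise ε g) v = D ^ n * biasedMass s v := hTT
    simp only [hTT']
    rw [mean, ← Finset.mul_sum, sum_biasedMass, div_pow, mul_one]
  have hTC : lpNorm 2 (noise ε gC) ^ 2 ≤ (D / 2) ^ n * (1 / 4) := by
    refine (lpNorm_noise_sq_le hε1 (g := g) (fun v => ?_) (fun v => ?_)).trans ?_
    · simp only [hgC]; split_ifs
      · exact le_rfl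
      · exact hg0 v
    · simp only [hgC]; split_ifs
      · exact hg0 v
      · exact le_rfl
    · have hfar := sum_biasedMass_far_le (n := n) hs0 hs1 hη hn
      have e : ∀ v, gC v * noise ε (noise ε g) v =
          D ^ n * (if |(wt v : ℝ) - n * s| ≤ η * n then 0 else biasedMass s v) := fun v => by
        simp only [hgC]
        split_ifs
        · simp
        · exact hTT v
      simp only [e]
      rw [mean, ← Finset.mul_sum, div_pow, mul_div_right_comm]
      gcongr
  set R := lpNorm 2 (noise ε g) with hR
  have hR0 : 0 ≤ R := lpNorm_nonneg _ _
  have hC : lpNorm 2 (noise ε gC) ≤ R / 2 := by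
    refine le_of_abs_le (abs_le_of_sq_le_sq ?_ (by positivity))
    rw [div_pow, hTg]
    linarith
  have htri : R ≤ lpNorm 2 (noise ε gC) + lpNorm 2 (noise ε gW) := by
    rw [hR]
    conv_lhs => rw [hsplit]
    rw [noise_add]
    exact lpNorm_two_add_le _ _
  have hsum := lpNorm_two_noise_sum_le (ε := ε) S (c := fun k => z ^ k) (fun k => by positivity)
    (fun k => sphere n k)
  have hRs : √((D / 2) ^ n) = R := by rw [← hTg, sqrt_sq hR0]
  have hRpos : 0 < R := by rw [← hRs]; positivity
  rw [hRs]
  by_contra hcon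
  push Not at hcon
  have hcard : (S.card : ℝ) ≤ n + 1 := by
    have := Finset.card_filter_le (Finset.range (n + 1)) (fun k : ℕ => |(k : ℝ) - n * s| ≤ η * n)
    rw [Finset.card_range] at this
    exact_mod_cast this
  have hlt : ∀ k ∈ S, z ^ k * lpNorm 2 (noise ε (sphere n k)) < R / (2 * (n + 1)) := by
    intro k hk
    rw [hS, Finset.mem_filter, Finset.mem_range] at hk
    have := hcon k (Nat.lt_succ_iff.1 hk.1) hk.2
    rw [lt_div_iff₀ (by positivity)]
    linarith
  have hSne : S.Nonempty := by
    by_contra hne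
    rw [Finset.not_nonempty_iff_eq_empty] at hne
    rw [hne, Finset.sum_empty] at hsum
    have : lpNorm 2 (noise ε gW) ≤ 0 := by rw [hgW, hne]; exact hsum
    linarith
  have h1 := Finset.sum_lt_sum_of_nonempty hSne hlt
  rw [Finset.sum_const, nsmul_eq_mul] at h1
  have h2 : (S.card : ℝ) * (R / (2 * (n + 1))) ≤ R / 2 := by
    have h3 : 0 < R / (2 * ((n : ℝ) + 1)) := by positivity
    calc _ ≤ ((n : ℝ) + 1) * (R / (2 * (n + 1))) := by gcongr
      _ = R / 2 := by field_simp
  linarith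

lemma eventually_linear_le_two_rpow {c : ℝ} (hc : 0 < c) :
    ∀ᶠ n : ℕ in atTop, 2 * ((n : ℝ) + 1) ≤ 2 ^ (c * n) := by
  have hr : (1 : ℝ) < 2 ^ c := one_lt_rpow one_lt_two hc
  have h := tendsto_pow_const_div_const_pow_of_one_lt 1 hr
  have h2 := h.eventually (gt_mem_nhds (show (0 : ℝ) < 1 / 4 by norm_num))
  filter_upwards [h2, eventually_ge_atTop 1] with n hn hn1
  have hn1' : (1 : ℝ) ≤ n := by exact_mod_cast hn1
  rw [pow_one, div_lt_iff₀ (by positivity)] at hn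
  rw [rpow_mul zero_le_two, rpow_natCast]
  linarith

/-- Spheres whose size and whose noise norm have prescribed exponential order. -/
lemma eventually_exists_sphere (hε : ε ∈ Ioo (0 : ℝ) (1 / 2)) {α : ℝ} (hα : α ∈ Ioo (0 : ℝ) 1)
    {η : ℝ} (hη : 0 < η) :
    ∀ᶠ n : ℕ in atTop, ∃ k ≤ n,
      (2 : ℝ) ^ (n * (α - 1 - η)) ≤ mean (sphere n k) ∧
      mean (sphere n k) ≤ 2 ^ (n * (α - 1 + η)) ∧
      2 ^ (n * (phi ε α - η)) ≤ lpNorm 2 (noise ε (sphere n k)) := by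
  have hd0 := delta_pos hε
  have hd1 := delta_lt_half hε
  obtain ⟨z, hz, hzα⟩ := exists_entropyParam_eq hd0 hd1 (show α ∈ Icc (0 : ℝ) 1 from
    ⟨hα.1.le, hα.2.le⟩)
  have hz0 : 0 < z := lt_of_le_of_ne hz.1 (by
    rintro rfl; rw [entropyParam_zero] at hzα; exact hα.1.ne hzα)
  have hphi := phi_entropyParam hε hz
  rw [hzα] at hphi
  have hs0 := couplingBias_pos hd0 hd1 hz0
  have hs1 : 0 < 1 - couplingBias (2 * ε * (1 - ε)) z := by
    linarith [couplingBias_le_half hd0 hd1 hz]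
  have hD := couplingMass_pos hd0 hd1 hz.1
  have hl := log_pos one_lt_two
  have hsph := fun (n : ℕ) (η : ℝ) (hη : 0 < η) (hn : 1 ≤ n * η ^ 2) =>
    exists_sphere_noise_ge (n := n) hε hz hη hn
  have hupper := fun (n k : ℕ) => lpNorm_noise_sphere_sq_le (n := n) hε hz.1 k
  rw [entropyParam, H] at hzα
  rw [phiParam] at hphi
  generalize couplingBias (2 * ε * (1 - ε)) z = s at *
  generalize couplingMass (2 * ε * (1 - ε)) z = D at *
  -- `K` bounds the rates at which `z^k` and the point masses `s^k (1-s)^(n-k)` change with `k`, in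
  -- logarithms; a deviation `η'n` of `k` then costs at most a quarter of the allowed error `η`.
  set K := |log z| + |log s - log (1 - s)| + 1 with hK
  have hK0 : 0 < K := by positivity
  set η' := η * log 2 / (4 * K) with hη'
  have hη'0 : 0 < η' := by positivity
  have hηK : η' * K = η * log 2 / 4 := by rw [hη']; field_simp
  have hev : ∀ᶠ n : ℕ in atTop, 1 ≤ (n : ℝ) * η' ^ 2 := by
    have : Tendsto (fun n : ℕ => (n : ℝ) * η' ^ 2) atTop atTop :=
      tendsto_natCast_atTop_atTop.atTop_mul_const (by positivity)
    exact this.eventually_ge_atTop 1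
  filter_upwards [hev, eventually_linear_le_two_rpow (show 0 < η / 4 by positivity)] with n hn1 hn2
  obtain ⟨k, hkn, hk, hge⟩ := hsph n η' hη'0 hn1
  have hup := hupper n k
  refine ⟨k, hkn, ?_⟩
  set N := lpNorm 2 (noise ε (sphere n k))
  have hDn : 0 < (D / 2) ^ n := by positivity
  have hLpos : (0 : ℝ) < 2 * (n + 1) := by positivity
  have hzN : 0 < z ^ k * N := by
    have h1 : 0 < √((D / 2) ^ n) := by positivity
    exact pos_of_mul_pos_right (h1.trans_le hge) hLpos.le
  have hN : 0 < N := pos_of_mul_pos_right hzN (by positivity)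
  -- the probability of the sphere is not too small
  have hP : 1 ≤ (2 * ((n : ℝ) + 1)) ^ 2 * sphereMass n s k := by
    have h1 := pow_le_pow_left₀ (sqrt_nonneg _) hge 2
    rw [sq_sqrt hDn.le, mul_pow] at h1
    have h2 : (D / 2) ^ n * 1 ≤ (D / 2) ^ n * ((2 * ((n : ℝ) + 1)) ^ 2 * sphereMass n s k) := by
      calc _ = (D / 2) ^ n := mul_one _
        _ ≤ _ := h1
        _ ≤ (2 * ((n : ℝ) + 1)) ^ 2 * ((D / 2) ^ n * sphereMass n s k) := by gcongr
        _ = _ := by ring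
    exact le_of_mul_le_mul_left h2 hDn
  have hPpos : 0 < sphereMass n s k := pos_of_mul_pos_right (one_pos.trans_le hP) (by positivity)
  have hP1 : sphereMass n s k ≤ 1 := sphereMass_le_one hs0.le (by linarith) k
  have hPeq := sphereMass_eq (n := n) s k
  have hm : 0 < mean (sphere n k) := by
    rw [hPeq] at hPpos
    have := pos_of_mul_pos_left hPpos (by positivity)
    exact pos_of_mul_pos_right this (by positivity)
  -- The product measure is constant on the sphere, so a mass between `(2(n+1))⁻²` and 1 determines
  -- the size of the sphere up to a subexponential factor and the deviation of `k`.
  have hlogP : log (sphereMass n s k) =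
      n * log 2 + log (mean (sphere n k)) + (k * log s + (n - k) * log (1 - s)) := by
    rw [hPeq, log_mul (by positivity) (by positivity), log_mul (by positivity) hm.ne',
      log_mul (by positivity) (by positivity), log_pow, log_pow, log_pow, Nat.cast_sub hkn]
  have hlogL : log (2 * ((n : ℝ) + 1)) ≤ η / 4 * n * log 2 := by
    rw [← log_rpow two_pos]
    exact log_le_log hLpos hn2
  have hlogP0 : log (sphereMass n s k) ≤ 0 := log_nonpos hPpos.le hP1
  have hlogP1 : 0 ≤ 2 * log (2 * ((n : ℝ) + 1)) + log (sphereMass n s k) := by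
    have := log_nonneg hP
    rwa [log_mul (by positivity) hPpos.ne', log_pow] at this
  have hlogN : n * log (D / 2) / 2 ≤ log (2 * ((n : ℝ) + 1)) + (k * log z + log N) := by
    have := log_le_log (by positivity) hge
    rwa [log_sqrt hDn.le, log_pow, log_mul hLpos.ne' hzN.ne', log_mul (by positivity) hN.ne',
      log_pow] at this
  have hent : α * log 2 = -s * log s - (1 - s) * log (1 - s) := by
    rw [← hzα, div_mul_cancel₀ _ hl.ne', binEntropy, log_inv, log_inv]
    ring
  have hphi' : phi ε α * log 2 = log (D / 2) / 2 - s * log z := by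
    rw [hphi, div_mul_cancel₀ _ hl.ne']
  have hdev : ∀ t, |t| ≤ K → |((k : ℝ) - n * s) * t| ≤ n * (η * log 2 / 4) := by
    intro t ht
    rw [abs_mul, ← hηK]
    calc _ ≤ (η' * n) * K := mul_le_mul hk ht (abs_nonneg _) (by positivity)
      _ = _ := by ring
  have hdev1 := abs_le.1 (hdev (log z) (by rw [hK]; linarith [abs_nonneg (log s - log (1 - s))]))
  have hdev2 := abs_le.1 (hdev (log s - log (1 - s)) (by rw [hK]; linarith [abs_nonneg (log z)]))
  have hnη : 0 ≤ n * (η * log 2) := by positivity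
  refine ⟨?_, ?_, ?_⟩
  · rw [← log_le_log_iff (by positivity) hm, log_rpow two_pos]
    linear_combination hlogP1 + 2 * hlogL + hdev2.2 + hlogP + n * hent + 1 / 4 * hnη
  · rw [← log_le_log_iff hm (by positivity), log_rpow two_pos]
    linear_combination hlogP0 + hdev2.1 - hlogP - n * hent + 3 / 4 * hnη
  · rw [← log_le_log_iff (by positivity) hN, log_rpow two_pos]
    linear_combination hlogN + hlogL + hdev1.2 + n * hphi' + 1 / 2 * hnη

end Spheres

/-! ### Tightness. -/

section Tightness

variable {n : ℕ} {ε q : ℝ}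

lemma mean_sphere_zero (n : ℕ) : mean (sphere n 0) = 1 / 2 ^ n := by
  have : ∀ v : Cube n, sphere n 0 v = if v = (fun _ => false) then 1 else 0 := fun v => by
    simp only [sphere, hammingDist_eq_zero]
  simp only [mean, this, Finset.sum_ite_eq', Finset.mem_univ, if_true]

lemma sphere_rpow {p : ℝ} (hp : p ≠ 0) (b : ℝ) (k : ℕ) (v : Cube n) :
    (b * sphere n k v) ^ p = b ^ p * sphere n k v := by
  rw [sphere_apply]
  split_ifs
  · simp
  · simp [zero_rpow hp]

lemma add_three_rpow_le {x y z p : ℝ} (hx : 0 ≤ x) (hy : 0 ≤ y) (hz : 0 ≤ z) (hp : 0 ≤ p) :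
    (x + y + z) ^ p ≤ 3 ^ p * (x ^ p + y ^ p + z ^ p) := by
  have hx' := rpow_nonneg hx p
  have hy' := rpow_nonneg hy p
  have hz' := rpow_nonneg hz p
  have key : ∀ t, 0 ≤ t → x ≤ t → y ≤ t → z ≤ t → t ^ p ≤ x ^ p + y ^ p + z ^ p →
      (x + y + z) ^ p ≤ 3 ^ p * (x ^ p + y ^ p + z ^ p) := by
    intro t ht h1 h2 h3 h4
    calc (x + y + z) ^ p ≤ (3 * t) ^ p := by gcongr; linarith
      _ = 3 ^ p * t ^ p := mul_rpow (by norm_num) ht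
      _ ≤ _ := by gcongr
  rcases le_total x y with h | h
  · rcases le_total y z with h' | h'
    · exact key z hz (h.trans h') h' le_rfl (by linarith)
    · exact key y hy h le_rfl h' (by linarith)
  · rcases le_total x z with h' | h'
    · exact key z hz h' (h.trans h') le_rfl (by linarith)
    · exact key x hx le_rfl h h' (by linarith)

lemma le_renyiEnt (hq : 1 < q) {f : Cube n → ℝ} {X : ℝ} (hX : 0 < X)
    (h : X ≤ mean (fun v => |f v| ^ q)) : 1 / (q - 1) * Real.logb 2 X ≤ renyiEnt q f := by
  have : 0 < q - 1 := by linarith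
  rw [renyiEnt, lpNorm_rpow (by linarith)]
  gcongr
  exact one_lt_two

lemma lpNorm_add_spheres_le {p a b c A : ℝ} (hp : 1 ≤ p) (ha : 0 ≤ a) (hb : 0 ≤ b) (hc : 0 ≤ c)
    {k : ℕ} (haA : a ≤ A) (hbA : b ^ p * mean (sphere n k) ≤ A ^ p)
    (hcA : c ^ p * mean (sphere n 0) ≤ A ^ p) :
    lpNorm p (fun v => a + b * sphere n k v + c * sphere n 0 v) ≤ 9 * A := by
  have hp0 : 0 < p := by linarith
  have hA : 0 ≤ A := ha.trans haA
  have hS := fun v : Cube n => mul_nonneg hb (sphere_nonneg k v)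
  have hS0 := fun v : Cube n => mul_nonneg hc (sphere_nonneg 0 v)
  rw [← rpow_le_rpow_iff (lpNorm_nonneg _ _) (by positivity) hp0, lpNorm_rpow hp0,
    mul_rpow (by norm_num) hA]
  have h1 : mean (fun v => |a + b * sphere n k v + c * sphere n 0 v| ^ p) ≤
      3 ^ p * (a ^ p + b ^ p * mean (sphere n k) + c ^ p * mean (sphere n 0)) := by
    have e : a ^ p + b ^ p * mean (sphere n k) + c ^ p * mean (sphere n 0) =
        mean (fun v => a ^ p + b ^ p * sphere n k v + c ^ p * sphere n 0 v) := by
      rw [mean_add, mean_add, mean_const, mean_const_mul, mean_const_mul]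
    rw [e, ← mean_const_mul]
    refine mean_mono fun v => ?_
    rw [abs_of_nonneg (by linarith [hS v, hS0 v]), ← sphere_rpow hp0.ne', ← sphere_rpow hp0.ne']
    exact add_three_rpow_le ha (hS v) (hS0 v) hp0.le
  have h2 : a ^ p ≤ A ^ p := rpow_le_rpow ha haA hp0.le
  -- One factor `3^p` comes from the power of a sum of three terms, the other absorbs the sum of
  -- three bounds by `A^p`.
  have h9 : (9 : ℝ) ^ p = 3 ^ p * 3 ^ p := by
    rw [← mul_rpow (by norm_num) (by norm_num)]; norm_num
  have h3p : (3 : ℝ) ≤ 3 ^ p := by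
    conv_lhs => rw [← rpow_one 3]
    exact rpow_le_rpow_of_exponent_le (by norm_num) hp
  refine h1.trans ?_
  rw [h9, mul_assoc]
  refine mul_le_mul_of_nonneg_left ?_ (by positivity)
  have := mul_le_mul_of_nonneg_right h3p (rpow_nonneg hA p)
  linarith

/-- A constant plus a multiple of a sphere plus a multiple of a point mass, for which the noise
norm exceeds a given norm. -/
lemma eventually_exists_large_noise (hε : ε ∈ Ioo (0 : ℝ) (1 / 2)) {α p w η : ℝ}
    (hα : α ∈ Ioo (0 : ℝ) 1) (hp : 1 ≤ p) (hs : chordSlope ε α < 1 / p) (hw : w < 1)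
    (hwp : w < 1 / p + (1 - α) * (1 - chordSlope ε α)) (hη : 0 < η) {c : ℕ → ℝ}
    (hc0 : ∀ n, 0 ≤ c n) (hcw : ∀ n, c n ≤ 2 ^ (n * w)) :
    ∀ᶠ n : ℕ in atTop, ∃ k ≤ n, ∃ a b : ℝ, 0 < a ∧ 0 < b ∧ b * mean (sphere n k) = 1 / 4 ∧
      mean (sphere n k) ≤ 2 ^ (n * (α - 1 + η)) ∧
      mean (fun v => a + b * sphere n k v + c n * sphere n 0 v) = 1 ∧
      lpNorm p (fun v => a + b * sphere n k v + c n * sphere n 0 v) <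
        lpNorm 2 (noise ε (fun v => a + b * sphere n k v + c n * sphere n 0 v)) := by
  have hε' : ε ∈ Ico (0 : ℝ) (1 / 2) := ⟨hε.1.le, hε.2⟩
  have hα' : α ∈ Ico (0 : ℝ) 1 := ⟨hα.1.le, hα.2⟩
  have hs1 := chordSlope_lt_one hε' hα'
  have hp0 : 0 < p := by linarith
  have hα1 : 0 < 1 - α := by linarith [hα.2]
  have hphi : 1 - α + phi ε α = (1 - α) * (1 - chordSlope ε α) := by
    rw [phi_eq_chordSlope hα.2]; ring
  generalize chordSlope ε α = s at *
  have hE1 : 0 < (1 - α) * (1 - s) := mul_pos hα1 (by linarith)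
  have hE2 : (1 - α) * (1 - 1 / p) < (1 - α) * (1 - s) :=
    mul_lt_mul_of_pos_left (by linarith) hα1
  set E := (1 - α) * (1 - s) with hE
  -- The three entries are the exponential rates of the `L^p` norms of the constant, the sphere and
  -- the point mass; `E` is the rate of the noise norm of the sphere part.
  set M := max 0 (max ((1 - α) * (1 - 1 / p)) (w - 1 / p)) with hM
  have hME : M < E := max_lt hE1 (max_lt hE2 (by linarith))
  have hM0 : 0 ≤ M := le_max_left _ _
  have hM1 : (1 - α) * (1 - 1 / p) ≤ M := (le_max_left _ _).trans (le_max_right _ _)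
  have hM2 : w - 1 / p ≤ M := (le_max_right _ _).trans (le_max_right _ _)
  -- The errors cost `θ` above and `2θ` below; `3θ ≤ (E-M)/2` leaves half of the gap to beat the
  -- constant factor 36. With `n ≥ 18`, `2(n+1)` exceeds 36.
  set θ := min η ((E - M) / 6) with hθ
  have hθ0 : 0 < θ := lt_min hη (by linarith)
  have hθη : θ ≤ η := min_le_left _ _
  have hθE : θ ≤ (E - M) / 6 := min_le_right _ _
  filter_upwards [eventually_exists_sphere hε hα hθ0, eventually_ge_atTop 18,
    eventually_linear_le_two_rpow (show 0 < (E - M) / 2 by linarith),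
    eventually_linear_le_two_rpow (show 0 < 1 - w by linarith)] with n hsph hn18 hnE hnw
  obtain ⟨k, hkn, hm1, hm2, hN⟩ := hsph
  have hn18' : (18 : ℝ) ≤ n := by exact_mod_cast hn18
  have hn0 : (0 : ℝ) ≤ n := by linarith
  set m := mean (sphere n k) with hmdef
  have hm : 0 < m := lt_of_lt_of_le (by positivity) hm1
  have hcn := hcw n
  have hc := hc0 n
  have hpw : (0 : ℝ) < 2 ^ n := by positivity
  have hcm : c n * (1 / 2 ^ n) ≤ 1 / 4 := by
    have h1 : (2 : ℝ) ^ (n * w) * 2 ^ ((1 - w) * n) = 2 ^ n := by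
      rw [← rpow_add two_pos, ← rpow_natCast]; congr 1; ring
    have h2 : c n * 4 ≤ 2 ^ n := by
      rw [← h1]
      exact mul_le_mul hcn (by linarith) (by norm_num) (by positivity)
    rw [mul_one_div, div_le_iff₀ hpw]
    linarith
  have hcm0 : 0 ≤ c n * (1 / 2 ^ n) := by positivity
  -- The sphere has mean `1/4` and the point mass at most `1/4`, which leaves at least `1/2` for the
  -- constant.
  set a := 1 - 1 / 4 - c n * (1 / 2 ^ n) with ha
  set b := 1 / (4 * m) with hb
  have ha0 : 0 < a := by linarith
  have ha1 : a ≤ 1 := by linarith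
  have hb0 : 0 < b := by positivity
  have hbm : b * m = 1 / 4 := by rw [hb]; field_simp
  refine ⟨k, hkn, a, b, ha0, hb0, hbm, hm2.trans ?_, ?_, ?_⟩
  · exact rpow_le_rpow_of_exponent_le one_le_two (by gcongr)
  · rw [mean_add, mean_add, mean_const, mean_const_mul, mean_const_mul, mean_sphere_zero,
      ← hmdef, hbm]
    ring
  set f : Cube n → ℝ := fun v => a + b * sphere n k v + c n * sphere n 0 v with hf
  have hS := fun v : Cube n => mul_nonneg hb0.le (sphere_nonneg k v)
  have hS0 := fun v : Cube n => mul_nonneg hc (sphere_nonneg 0 v)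
  have hf0 : ∀ v, 0 ≤ f v := fun v => by
    have := hS v; have := hS0 v
    simp only [hf]; positivity
  have hlow : 1 / 4 * 2 ^ (n * (E - 2 * θ)) ≤ lpNorm 2 (noise ε f) := by
    have hε1 : ε ∈ Icc (0 : ℝ) 1 := ⟨hε.1.le, by linarith [hε.2]⟩
    have h1 : b * lpNorm 2 (noise ε (sphere n k)) ≤ lpNorm 2 (noise ε f) := by
      rw [← lpNorm_const_mul two_pos hb0.le, ← noise_const_mul]
      refine (pow_le_pow_iff_left₀ (lpNorm_nonneg _ _) (lpNorm_nonneg _ _) two_ne_zero).1 ?_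
      rw [lpNorm_two_sq, lpNorm_two_sq]
      refine mean_mono fun v => pow_le_pow_left₀ (noise_nonneg hε1 hS v) ?_ 2
      refine noise_mono hε1 (fun v => ?_) v
      have := hS v; have := hS0 v
      simp only [hf]; linarith
    refine le_trans ?_ h1
    have h2 : 1 / 4 * (2 : ℝ) ^ (n * (1 - α - θ)) ≤ b := by
      rw [hb, one_div_mul_eq_div, div_le_div_iff₀ (by norm_num) (by positivity), one_mul]
      have h3 : (2 : ℝ) ^ (n * (1 - α - θ)) * 2 ^ (n * (α - 1 + θ)) = 1 := by
        rw [← rpow_add two_pos, ← mul_add]; simp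
      have h4 : (2 : ℝ) ^ (n * (1 - α - θ)) * m ≤ 1 :=
        (mul_le_mul_of_nonneg_left hm2 (by positivity)).trans_eq h3
      linarith
    calc _ = (1 / 4 * (2 : ℝ) ^ (n * (1 - α - θ))) * 2 ^ (n * (phi ε α - θ)) := by
          rw [mul_assoc, ← rpow_add two_pos, ← hphi]
          ring_nf
      _ ≤ _ := by gcongr
  have hupp : lpNorm p f ≤ 9 * 2 ^ (n * (M + θ)) := by
    have hQ : ((2 : ℝ) ^ (n * (M + θ))) ^ p = 2 ^ (n * (M + θ) * p) := by
      rw [← rpow_mul zero_le_two]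
    refine lpNorm_add_spheres_le hp ha0.le hb0.le hc
      (ha1.trans (one_le_rpow one_le_two (by positivity))) ?_ ?_
    · have h2 : b ≤ 2 ^ (n * (1 - α + θ)) := by
        have h3 : (2 : ℝ) ^ (n * (1 - α + θ)) * 2 ^ (n * (α - 1 - θ)) = 1 := by
          rw [← rpow_add two_pos, ← mul_add]; simp
        have h4 : 1 ≤ (2 : ℝ) ^ (n * (1 - α + θ)) * m :=
          h3.symm.trans_le (mul_le_mul_of_nonneg_left hm1 (by positivity))
        rw [hb, div_le_iff₀ (by positivity)]
        linarith
      have h5 : b ^ p * m = b ^ (p - 1) * (1 / 4) := by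
        rw [← hbm, rpow_sub_one hb0.ne']; field_simp
      have h6 : b ^ (p - 1) ≤ 2 ^ (n * (M + θ) * p) := by
        refine (rpow_le_rpow hb0.le h2 (by linarith)).trans ?_
        rw [← rpow_mul zero_le_two]
        refine rpow_le_rpow_of_exponent_le one_le_two ?_
        have h7 := mul_le_mul_of_nonneg_right hM1 hp0.le
        have h8 : (1 - α) * (1 - 1 / p) * p = (1 - α) * (p - 1) := by field_simp
        have h9 : (1 - α + θ) * (p - 1) ≤ (M + θ) * p := by linarith
        rw [mul_assoc, mul_assoc]
        exact mul_le_mul_of_nonneg_left h9 hn0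
      have : 0 ≤ b ^ (p - 1) := rpow_nonneg hb0.le _
      rw [← hmdef, h5, hQ]
      linarith
    · have h2 : c n ^ p ≤ 2 ^ (n * w * p) := by
        rw [rpow_mul zero_le_two]
        exact rpow_le_rpow hc hcn hp0.le
      have h3 : (2 : ℝ) ^ (n * w * p) * (1 / 2 ^ n) = 2 ^ (n * ((w - 1 / p) * p)) := by
        rw [mul_one_div, ← rpow_natCast 2 n, ← rpow_sub two_pos]
        congr 1
        field_simp
      rw [mean_sphere_zero, hQ]
      refine (mul_le_mul_of_nonneg_right h2 (by positivity)).trans ?_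
      rw [h3, mul_assoc]
      refine rpow_le_rpow_of_exponent_le one_le_two (mul_le_mul_of_nonneg_left ?_ hn0)
      exact mul_le_mul_of_nonneg_right (by linarith) hp0.le
  refine hupp.trans_lt (lt_of_lt_of_le ?_ hlow)
  have h36 : (36 : ℝ) < 2 ^ ((E - M) / 2 * n) := by linarith
  calc 9 * (2 : ℝ) ^ (n * (M + θ)) = 1 / 4 * (36 * 2 ^ (n * (M + θ))) := by ring
    _ < 1 / 4 * (2 ^ ((E - M) / 2 * n) * 2 ^ (n * (M + θ))) :=
      mul_lt_mul_of_pos_left (mul_lt_mul_of_pos_right h36 (by positivity)) (by norm_num)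
    _ = 1 / 4 * 2 ^ ((E - M) / 2 * n + n * (M + θ)) := by rw [rpow_add two_pos]
    _ ≤ _ := by
      have h1 : (E - M) / 2 + (M + θ) ≤ E - 2 * θ := by linarith
      have h2 := mul_le_mul_of_nonneg_left h1 hn0
      refine mul_le_mul_of_nonneg_left (rpow_le_rpow_of_exponent_le one_le_two ?_) (by norm_num)
      linarith

lemma le_mean_abs_rpow (hq : 0 < q) {a b c : ℝ} (ha : 0 ≤ a) (hb : 0 ≤ b) (hc : 0 ≤ c)
    (k : ℕ) :
    b ^ q * mean (sphere n k) ≤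
        mean (fun v => |a + b * sphere n k v + c * sphere n 0 v| ^ q) ∧
      c ^ q * mean (sphere n 0) ≤
        mean (fun v => |a + b * sphere n k v + c * sphere n 0 v| ^ q) := by
  rw [← mean_const_mul, ← mean_const_mul]
  have hS := fun v : Cube n => mul_nonneg hb (sphere_nonneg k v)
  have hS0 := fun v : Cube n => mul_nonneg hc (sphere_nonneg 0 v)
  constructor
  · refine mean_mono fun v => ?_
    rw [← sphere_rpow hq.ne']
    exact rpow_le_rpow (hS v) (le_abs.2 (Or.inl (by linarith [hS0 v]))) hq.le
  · refine mean_mono fun v => ?_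
    rw [← sphere_rpow hq.ne']
    exact rpow_le_rpow (hS0 v) (le_abs.2 (Or.inl (by linarith [hS v]))) hq.le

/-- In the regime `κ = 1/s(1-x)` a sphere of density slightly below `2^(-nx)` supplies both the
entropy and the noise norm. In the other two regimes the sphere supplies the noise norm and the
point mass the entropy. -/
theorem exists_lpNorm_lt_lpNorm_noise (hq : 1 < q) {x : ℝ} (hx : x ∈ Ioo (0 : ℝ) 1)
    (hε : ε ∈ Ioo (0 : ℝ) (1 / 2)) {y : ℝ} (hy0 : 0 < y) (hy : y < kappa q x ε) (n₀ : ℕ) :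
    ∃ n : ℕ, n₀ ≤ n ∧ 1 ≤ n ∧ ∃ r s : ℕ, r ≤ n ∧ s ≤ n ∧ ∃ a b c : ℝ,
      0 < a ∧ 0 < b ∧ 0 ≤ c ∧ ∃ f : Cube n → ℝ,
        f = (fun v => a + b * sphere n r v + c * sphere n s v) ∧
        mean f = 1 ∧ x ≤ renyiEnt q f / n ∧ lpNorm y f < lpNorm 2 (noise ε f) := by
  have hε' : ε ∈ Ico (0 : ℝ) (1 / 2) := ⟨hε.1.le, hε.2⟩
  have hε'' : ε ∈ Icc (0 : ℝ) (1 / 2) := ⟨hε.1.le, hε.2.le⟩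
  have hxI : x ∈ Icc (0 : ℝ) 1 := ⟨hx.1.le, hx.2.le⟩
  have hq0 : 0 < q := by linarith
  have hq1 : 0 < q - 1 := by linarith
  -- it suffices to consider exponents at least `1`
  set p := max y 1 with hpdef
  have hp1 : 1 ≤ p := le_max_right _ _
  have hyp : y ≤ p := le_max_left _ _
  have hp0 : 0 < p := by linarith
  have hlt : ∀ α ∈ Ico (0 : ℝ) 1, p < 1 / chordSlope ε α → chordSlope ε α < 1 / p := by
    intro α hα h
    have hs := chordSlope_pos hε'' hα
    rw [lt_div_iff₀ hs] at h
    rwa [lt_div_iff₀ hp0, mul_comm]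
  have hone : ∀ α ∈ Ico (0 : ℝ) 1, y < 1 / chordSlope ε α → p < 1 / chordSlope ε α := by
    intro α hα h
    refine max_lt h ?_
    rw [lt_div_iff₀ (chordSlope_pos hε'' hα), one_mul]
    exact chordSlope_lt_one hε' hα
  have hyLin1 : yLin q x < 1 := by
    refine (yLin_strictMono hq hx.2).trans_le (yLin_le_one hq le_rfl)
  -- the case of a nontrivial point mass
  have caseB : ∀ α ∈ Ioo (0 : ℝ) 1, chordSlope ε α < 1 / p →
      yLin q x < 1 / p + (1 - α) * (1 - chordSlope ε α) →
      ∃ n : ℕ, n₀ ≤ n ∧ 1 ≤ n ∧ ∃ r s : ℕ, r ≤ n ∧ s ≤ n ∧ ∃ a b c : ℝ,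
        0 < a ∧ 0 < b ∧ 0 ≤ c ∧ ∃ f : Cube n → ℝ,
          f = (fun v => a + b * sphere n r v + c * sphere n s v) ∧
          mean f = 1 ∧ x ≤ renyiEnt q f / n ∧ lpNorm y f < lpNorm 2 (noise ε f) := by
    intro α hα hs hyl
    have hev := eventually_exists_large_noise hε hα hp1 hs hyLin1 hyl one_pos
      -- This height gives the point mass alone `c^q / 2^n = 2^(n(q-1)x)`, exactly the required
      -- entropy.
      (c := fun n => 2 ^ (n * yLin q x)) (fun n => by positivity) (fun n => le_rfl)
    obtain ⟨n, ⟨k, hkn, a, b, ha, hb, -, -, hmean, hN⟩, hn⟩ :=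
      (hev.and (eventually_ge_atTop (max n₀ 1))).exists
    have hn1 : 1 ≤ n := (le_max_right _ _).trans hn
    refine ⟨n, (le_max_left _ _).trans hn, hn1, k, 0, hkn, n.zero_le, a, b, _, ha, hb,
      by positivity, _, rfl, hmean, ?_, (lpNorm_mono_exp hy0 hyp _).trans_lt hN⟩
    have hnpos : (0 : ℝ) < n := by exact_mod_cast hn1
    rw [le_div_iff₀ hnpos]
    have hX := (le_mean_abs_rpow (n := n) hq0 ha.le hb.le
      (show (0 : ℝ) ≤ 2 ^ (n * yLin q x) by positivity) k).2
    rw [mean_sphere_zero, ← rpow_natCast 2 n, ← rpow_mul zero_le_two, mul_one_div,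
      ← rpow_sub two_pos] at hX
    refine le_trans (le_of_eq ?_) (le_renyiEnt hq (by positivity) hX)
    rw [Real.logb_rpow two_pos (by norm_num), yLin]
    field_simp
    ring
  rcases kappa_cases hε'' hq hxI with ⟨h, h0 | hyl⟩ | ⟨h0, -, h, -⟩ | ⟨-, α, hα, hαe, -, h, -⟩
  · exact absurd h0 hx.1.ne'
  · rw [h] at hy
    have hpq : p < q0 ε := max_lt hy (by
      unfold q0
      have : 0 < 1 - 2 * ε := by linarith [hε.2]
      nlinarith [sq_pos_of_pos this])
    have hq0p : 1 / q0 ε < 1 / p := one_div_lt_one_div_of_lt hp0 hpq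
    obtain ⟨α, hα, hs⟩ := exists_chordSlope_lt hε'' hq0p
    have hα' : α ∈ Ico (0 : ℝ) 1 := ⟨hα.1.le, hα.2⟩
    refine caseB α hα hs ?_
    have := mul_pos (sub_pos.2 hα.2) (sub_pos.2 (chordSlope_lt_one hε' hα'))
    linarith
  · rw [h] at hy
    have hxI' : 1 - x ∈ Ioo (0 : ℝ) 1 := ⟨by linarith [hx.2], by linarith⟩
    have hxI'' : 1 - x ∈ Ico (0 : ℝ) 1 := ⟨hxI'.1.le, hxI'.2⟩
    have hs := hlt _ hxI'' (hone _ hxI'' hy)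
    have hcont : ContinuousAt (chordSlope ε) (1 - x) :=
      (continuousOn_chordSlope hε'').continuousAt (Ico_mem_nhds hxI'.1 hxI'.2)
    -- Moving `α` slightly below `1-x` keeps the strict slope inequality and leaves entropy to
    -- spare.
    have hev : ∀ᶠ α in 𝓝[<] (1 - x), chordSlope ε α < 1 / p :=
      nhdsWithin_le_nhds (hcont.eventually (gt_mem_nhds hs))
    obtain ⟨α, hαs, hα⟩ := (hev.and (Ioo_mem_nhdsLT hxI'.1)).exists
    have hαI : α ∈ Ioo (0 : ℝ) 1 := ⟨hα.1, hα.2.trans hxI'.2⟩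
    have hη : 0 < (1 - x - α) / 2 := by linarith [hα.2]
    have hE := mul_pos (sub_pos.2 hαI.2)
      (sub_pos.2 (chordSlope_lt_one hε' ⟨hαI.1.le, hαI.2⟩))
    have h1p : 0 < 1 / p := by positivity
    have hev := eventually_exists_large_noise hε hαI hp1 hαs (w := 0) zero_lt_one
      (by linarith) hη (c := fun _ => 0) (fun _ => le_rfl) (fun n => by positivity)
    -- The mean `1/4` of the sphere part costs `2q/(q-1)` bits of entropy. Half of the spare
    -- `n(1-x-α)` absorbs this, the other half the error in the density.
    have hbig : ∀ᶠ n : ℕ in atTop, 2 * q / (q - 1) ≤ n * ((1 - x - α) / 2) :=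
      (tendsto_natCast_atTop_atTop.atTop_mul_const hη).eventually_ge_atTop _
    obtain ⟨n, ⟨k, hkn, a, b, ha, hb, hbm, hm, hmean, hN⟩, hn, hnb⟩ :=
      (hev.and ((eventually_ge_atTop (max n₀ 1)).and hbig)).exists
    have hn1 : 1 ≤ n := (le_max_right _ _).trans hn
    refine ⟨n, (le_max_left _ _).trans hn, hn1, k, 0, hkn, n.zero_le, a, b, 0, ha, hb,
      le_rfl, _, rfl, hmean, ?_, (lpNorm_mono_exp hy0 hyp _).trans_lt hN⟩
    have hnpos : (0 : ℝ) < n := by exact_mod_cast hn1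
    rw [le_div_iff₀ hnpos]
    have hX := (le_mean_abs_rpow (n := n) hq0 ha.le hb.le le_rfl k).1
    have hmpos : 0 < mean (sphere n k) := by
      have : 0 < b * mean (sphere n k) := by rw [hbm]; norm_num
      exact pos_of_mul_pos_right this hb.le
    refine le_trans ?_ (le_renyiEnt hq (by positivity) hX)
    have hbeq : Real.logb 2 b = -2 - Real.logb 2 (mean (sphere n k)) := by
      have h1 : Real.logb 2 (b * mean (sphere n k)) = -2 := by
        rw [hbm, show (1 / 4 : ℝ) = 2 ^ (-2 : ℝ) by
          rw [rpow_neg zero_le_two, rpow_two]; norm_num, Real.logb_rpow two_pos (by norm_num)]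
      rw [Real.logb_mul hb.ne' hmpos.ne'] at h1
      linarith
    have hlm : Real.logb 2 (mean (sphere n k)) ≤ n * (α - 1 + (1 - x - α) / 2) := by
      rw [Real.logb_le_iff_le_rpow one_lt_two hmpos]
      exact hm
    rw [Real.logb_mul (by positivity) hmpos.ne', Real.logb_rpow_eq_mul_logb_of_pos hb, hbeq]
    generalize Real.logb 2 (mean (sphere n k)) = l at *
    rw [div_le_iff₀ hq1] at hnb
    rw [one_div_mul_eq_div, le_div_iff₀ hq1]
    nlinarith [mul_le_mul_of_nonneg_left hlm hq1.le]
  · rw [h] at hy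
    -- `α = 0` would force `yLin q x = 1`, which is excluded by `x < 1`.
    have hα0 : 0 < α := lt_of_le_of_ne hα.1 (by
      rintro rfl
      simp only [alphaEq, sub_zero, zero_mul, add_zero] at hαe
      linarith)
    have hs := hlt α hα (hone α hα hy)
    refine caseB α ⟨hα0, hα.2⟩ hs ?_
    -- The equation reads `yLin q x = s + (1-α)(1-s)`, and `s < 1/p`.
    rw [← hαe, alphaEq]
    linarith

end Tightness

end

end NoiseCube

theorem theorem1p2 (q : ℝ) (hq : 1 < q) :
    -- `κ_{2,q}` is well defined on `[0,1] × [0,1/2]`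
    (∀ ε ∈ Set.Icc (0 : ℝ) (1 / 2), ∀ x ∈ Set.Ioc (0 : ℝ) 1,
      NoiseCube.phi ε (1 - x) ≠ 0 ∧
      (1 / NoiseCube.q0 ε < NoiseCube.yLin q x →
        ∃! α, NoiseCube.IsAlpha0 ε (NoiseCube.yLin q x) α)) ∧
    -- it is decreasing in its first argument
    (∀ ε ∈ Set.Icc (0 : ℝ) (1 / 2),
      AntitoneOn (fun x => NoiseCube.kappa q x ε) (Set.Icc 0 1)) ∧
    -- its value at `0`
    (∀ ε ∈ Set.Icc (0 : ℝ) (1 / 2), NoiseCube.kappa q 0 ε = 1 + (1 - 2 * ε) ^ 2) ∧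
    -- the hypercontractive inequality
    (∀ ε ∈ Set.Icc (0 : ℝ) (1 / 2), ∀ n : ℕ, 1 ≤ n → ∀ f : NoiseCube.Cube n → ℝ, f ≠ 0 →
      NoiseCube.renyiEnt q (fun v => f v / NoiseCube.lpNorm 1 f) / n ∈ Set.Icc (0 : ℝ) 1 ∧
      NoiseCube.lpNorm 2 (NoiseCube.noise ε f) ≤
        NoiseCube.lpNorm
          (NoiseCube.kappa q
            (NoiseCube.renyiEnt q (fun v => f v / NoiseCube.lpNorm 1 f) / n) ε) f) ∧
    -- tightness, attained by combinations of the uniform distribution and Hamming spheres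
    (∀ x ∈ Set.Ioo (0 : ℝ) 1, ∀ ε ∈ Set.Ioo (0 : ℝ) (1 / 2),
      ∀ y : ℝ, 0 < y → y < NoiseCube.kappa q x ε → ∀ n₀ : ℕ,
      ∃ n : ℕ, n₀ ≤ n ∧ 1 ≤ n ∧ ∃ r s : ℕ, r ≤ n ∧ s ≤ n ∧ ∃ a b c : ℝ,
        0 < a ∧ 0 < b ∧ 0 ≤ c ∧ ∃ f : NoiseCube.Cube n → ℝ,
          f = (fun v => a + b * NoiseCube.sphere n r v + c * NoiseCube.sphere n s v) ∧
          NoiseCube.mean f = 1 ∧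
          x ≤ NoiseCube.renyiEnt q f / n ∧
          NoiseCube.lpNorm y f < NoiseCube.lpNorm 2 (NoiseCube.noise ε f)) := by
  refine ⟨fun ε hε x hx => ⟨fun h => ?_, fun hy => ?_⟩, fun ε hε => ?_, fun ε _ => ?_,
    fun ε hε n hn f hf => ?_, fun x hx ε hε y hy0 hy n₀ => ?_⟩
  · have := NoiseCube.chordSlope_pos hε (α := 1 - x) ⟨by linarith [hx.2], by linarith [hx.1]⟩
    rw [NoiseCube.chordSlope, h] at this
    simp at this
  · exact NoiseCube.existsUnique_isAlpha0 hε hy (NoiseCube.yLin_le_one hq hx.2)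
  · exact NoiseCube.kappa_antitoneOn hε hq
  · rw [NoiseCube.kappa, if_pos rfl, NoiseCube.q0]
  · exact NoiseCube.lpNorm_noise_le_kappa hε hq hn hf
  · exact NoiseCube.exists_lpNorm_lt_lpNorm_noise hq hx hε hy0 hy n₀
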